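/- **Setting.** Let $p(\mathbf y,\boldsymbol\theta)=p(\boldsymbol\theta)\,p(\mathbf y\mid\boldsymbol\theta)$ be a Bayesian model with parameter $\boldsymbol\theta\in\mathbb R^d$, $d\ge 2$, prior density $p(\boldsymbol\theta)$ with respect to Lebesgue measure, and sampling densities $p(\mathbf y\mid\boldsymbol\theta)$ (with respect to some $\sigma$-finite measure) that have a common support and are twice continuously differentiable in $\boldsymbol\theta$. Let $\mathcal J(\mathbf y,\boldsymbol\theta)_{ij}=-\partial_{\theta_i}\partial_{\theta_j}\log p(\mathbf y\mid\boldsymbol\theta)$ be the observed information and $\mathcal I(\boldsymbol\theta)=\mathbb E[\mathcal J(\mathbf y,\boldsymbol\theta)\mid\boldsymbol\theta]$ the Fisher information. For $n\ge 1$ the $n$-replicated model is $p(\mathbf y^{(1)},\dots,\mathbf y^{(n)},\boldsymbol\theta)=p(\boldsymbol\theta)\prod_{i=1}^n p(\mathbf y^{(i)}\mid\boldsymbol\theta)$. Write $h(\boldsymbol\theta\mid\mathbf x)$ for the average over $\mathbf x$ of the differential entropy of $p(\boldsymbol\theta\mid\mathbf x)$, and $\mathbf I(\boldsymbol\theta,\mathbf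 u\mid\mathbf x)=h(\boldsymbol\theta\mid\mathbf x)-h(\boldsymbol\theta\mid\mathbf x,\mathbf u)$ for the conditional mutual information. Let $\lambda_1$ and $\lambda_d$ be the smallest and largest eigenvalue of a symmetric matrix. **Theorem.** Let $\gamma,B>0$. There are constants $C,K>0$ depending only on $\gamma$ and $B$ such that the following holds for every $d\ge2$, every such model and every $R\ge 1$. Let $\widetilde{\mathbf y}_R$ be $R$ replications of the data, and $\Sigma_R=\mathrm{Cov}(\boldsymbol\theta\mid\widetilde{\mathbf y}_R)$. Suppose that 1. for all sufficiently large $M$ the posteriors $p(\boldsymbol\theta\mid\mathbf y^{(1)},\dots,\mathbf y^{(M)})$ are normal for almost all data; 2. the observed information is $\gamma$-subexponential given $\boldsymbol\theta$: there are $\alpha,\beta>0$ with $\alpha+\beta=\gamma$ such that, for almost every $\boldsymbol\theta$ and all $k\ge2$, $\mathbb E[\mathcal J(\mathbf y,\boldsymbol\theta)^k\mid\boldsymbol\theta]$ exists and $\mathbb E[\mathcal J(\mathbf y,\boldsymbol\theta)^k\mid\boldsymbol\theta]\preceq\alpha\frac{k!}{2}\beta^{k-2}\,\mathrm{Id}$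 in the Loewner order; 3. $\mathbb E\lambda_d(\Sigma_R)$, $\mathbb E\lambda_1(\Sigma_R)^{-1}$, $\mathbb E\lambda_d(\mathcal I(\boldsymbol\theta))^2$ and $\mathbb E\lambda_1(\mathcal I(\boldsymbol\theta))^{-1}$ are at most $B$. Then the conditional entropies $h(\boldsymbol\theta\mid\mathbf y^{(1)},\dots,\mathbf y^{(n)})$, $n\ge1$, and the expectation $\mathbb E\,\Sigma_R^{1/2}\mathcal I(\boldsymbol\theta)\Sigma_R^{1/2}$ over the joint law of $(\boldsymbol\theta,\widetilde{\mathbf y}_R)$ are finite, and $$\mathbf I(\boldsymbol\theta,\mathbf y_{\mathrm{rep}}\mid\mathbf y)\ \ge\ \frac{C}{\log d}\,\mathrm{tr}\Big(\mathbb E\,\Sigma_R^{1/2}\mathcal I(\boldsymbol\theta)\Sigma_R^{1/2}\Big),$$ where $\mathbf y,\mathbf y_{\mathrm{rep}}$ are two replications. In particular, for $R=1$ the right-hand side contains the covariance $\Sigma_{\mathbf y}$ of the posterior given $\mathbf y$. Moreover, for $M=\lceil K\log(2d)\rceil$ further replications $\overline{\mathbf y}_M$, $$\frac1M\,\mathbf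 I(\boldsymbol\theta,\overline{\mathbf y}_M\mid\widetilde{\mathbf y}_R)\ \ge\ \frac{C}{\log d}\,\mathrm{tr}\Big(\mathbb E\,\Sigma_R^{1/2}\mathcal I(\boldsymbol\theta)\Sigma_R^{1/2}\Big).$$ -/

import Mathlib

open MeasureTheory ProbabilityTheory Filter
open scoped ENNReal NNReal

noncomputable section

/-- Smallest eigenvalue `λ₁` of a real symmetric matrix. -/
def lamMin {d : ℕ} (A : Matrix (Fin d) (Fin d) ℝ) : ℝ := sInf (spectrum ℝ A)

/-- Largest eigenvalue `λ_d` of a real symmetric matrix. -/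
def lamMax {d : ℕ} (A : Matrix (Fin d) (Fin d) ℝ) : ℝ := sSup (spectrum ℝ A)

open scoped MatrixOrder in
/-- The positive semidefinite square root `A^{1/2}` of a positive semidefinite real matrix. -/
def matSqrt {d : ℕ} (A : Matrix (Fin d) (Fin d) ℝ) : Matrix (Fin d) (Fin d) ℝ := CFC.sqrt A

/-- The entrywise expectation of a random matrix. -/
def matExp {Ω : Type*} [MeasurableSpace Ω] {d : ℕ} (μ : Measure Ω)
    (X : Ω → Matrix (Fin d) (Fin d) ℝ) : Matrix (Fin d) (Fin d) ℝ :=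
  Matrix.of fun i j => ∫ ω, X ω i j ∂μ

/-- A random matrix with integrable entries. -/
def MatIntegrable {Ω : Type*} [MeasurableSpace Ω] {d : ℕ} (μ : Measure Ω)
    (X : Ω → Matrix (Fin d) (Fin d) ℝ) : Prop :=
  ∀ i j, Integrable (fun ω => X ω i j) μ

/-- `(α, β)`-subexponential random symmetric matrix: `E X ^ k ≼ α (k! / 2) β ^ (k - 2) I` in the
Loewner order for all `k ≥ 2`; the moments are required to exist. -/
def IsSubexponential {Ω : Type*} [MeasurableSpace Ω] {d : ℕ} (μ : Measure Ω)
    (X : Ω → Matrix (Fin d) (Fin d) ℝ) (α β : ℝ) : Prop :=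
  ∀ k : ℕ, 2 ≤ k →
    MatIntegrable μ (fun ω => X ω ^ k) ∧
    ((α * ((k.factorial : ℝ) / 2) * β ^ (k - 2)) • (1 : Matrix (Fin d) (Fin d) ℝ)
      - matExp μ (fun ω => X ω ^ k)).PosSemidef

/-- Differential entropy `- ∫ f log f` of a density on `ℝ^d`. -/
def diffEntropy {d : ℕ} (f : EuclideanSpace ℝ (Fin d) → ℝ) : ℝ :=
  ∫ t, Real.negMulLog (f t)

/-- A Bayesian model `p(y, θ) = p(θ) p(y ∣ θ)` with parameter `θ ∈ ℝ^d`, prior density `p(θ)` with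
respect to Lebesgue measure, and sampling densities `p(y ∣ θ)` with respect to `ν`.  The sampling
densities have a common support and are twice continuously differentiable in `θ`. -/
structure BayesModel (d : ℕ) {Y : Type*} [MeasurableSpace Y] (ν : Measure Y) where
  /-- the prior density `p(θ)` -/
  prior : EuclideanSpace ℝ (Fin d) → ℝ
  /-- the sampling density `p(y ∣ θ)` -/
  lik : Y → EuclideanSpace ℝ (Fin d) → ℝ
  prior_measurable : Measurable prior
  prior_nonneg : ∀ t, 0 ≤ prior t
  prior_mass : ∫⁻ t, ENNReal.ofReal (prior t) = 1
  lik_measurable : Measurable (Function.uncurry lik)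
  lik_mass : ∀ t, ∫⁻ y, ENNReal.ofReal (lik y t) ∂ν = 1
  lik_support : ∀ y, (∀ t, 0 < lik y t) ∨ (∀ t, lik y t = 0)
  lik_contDiff : ∀ y, ContDiff ℝ 2 (lik y)

namespace BayesModel

variable {d : ℕ} {Y : Type*} [MeasurableSpace Y] {ν : Measure Y} (P : BayesModel d ν)

/-- The prior distribution of `θ`. -/
def priorMeasure : Measure (EuclideanSpace ℝ (Fin d)) :=
  volume.withDensity fun t => ENNReal.ofReal (P.prior t)

/-- The sampling distribution of one data set given `θ`. -/
def sampling (t : EuclideanSpace ℝ (Fin d)) : Measure Y :=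
  ν.withDensity fun y => ENNReal.ofReal (P.lik y t)

/-- Density of the `n`-replicated model, `p(y⁽¹⁾, …, y⁽ⁿ⁾, θ) = p(θ) ∏ p(y⁽ⁱ⁾ ∣ θ)`. -/
def jointDensity {n : ℕ} (ys : Fin n → Y) (t : EuclideanSpace ℝ (Fin d)) : ℝ :=
  P.prior t * ∏ i, P.lik (ys i) t

/-- Joint law of `(θ, (y⁽¹⁾, …, y⁽ⁿ⁾))` in the `n`-replicated model. -/
def joint (n : ℕ) : Measure (EuclideanSpace ℝ (Fin d) × (Fin n → Y)) :=
  (volume.prod (Measure.pi fun _ => ν)).withDensity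
    fun z => ENNReal.ofReal (P.jointDensity z.2 z.1)

/-- Marginal law of `(y⁽¹⁾, …, y⁽ⁿ⁾)` in the `n`-replicated model. -/
def marginal (n : ℕ) : Measure (Fin n → Y) := (P.joint n).snd

/-- The posterior density `p(θ ∣ y⁽¹⁾, …, y⁽ⁿ⁾)`. -/
def posteriorDensity {n : ℕ} (ys : Fin n → Y) (t : EuclideanSpace ℝ (Fin d)) : ℝ :=
  P.jointDensity ys t / ∫ s, P.jointDensity ys s

/-- The posterior distribution of `θ` given `y⁽¹⁾, …, y⁽ⁿ⁾`. -/
def posterior {n : ℕ} (ys : Fin n → Y) : Measure (EuclideanSpace ℝ (Fin d)) :=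
  volume.withDensity fun t => ENNReal.ofReal (P.posteriorDensity ys t)

/-- The posterior covariance matrix `Cov(θ ∣ y⁽¹⁾, …, y⁽ⁿ⁾)`. -/
def posteriorCov {n : ℕ} (ys : Fin n → Y) : Matrix (Fin d) (Fin d) ℝ :=
  Matrix.of fun i j => covariance (fun t => t i) (fun t => t j) (P.posterior ys)

/-- The observed information matrix `J(y, θ)ᵢⱼ = - ∂²/∂θᵢ∂θⱼ log p(y ∣ θ)`. -/
def observedInfo (y : Y) (t : EuclideanSpace ℝ (Fin d)) : Matrix (Fin d) (Fin d) ℝ :=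
  Matrix.of fun i j =>
    -(fderiv ℝ
        (fun s => fderiv ℝ (fun r => Real.log (P.lik y r)) s (EuclideanSpace.single j 1)) t
        (EuclideanSpace.single i 1))

/-- The Fisher information matrix `I(θ) = E[J(y, θ) ∣ θ]`. -/
def fisherInfo (t : EuclideanSpace ℝ (Fin d)) : Matrix (Fin d) (Fin d) ℝ :=
  matExp (P.sampling t) (fun y => P.observedInfo y t)

/-- The observed information is `γ`-subexponential: for some `α, β > 0` with `α + β = γ`,
it is `(α, β)`-subexponential under the sampling distribution, for almost every `θ`. -/
def ObservedInfoSubexponential (γ : ℝ) : Prop :=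
  ∃ α β : ℝ, 0 < α ∧ 0 < β ∧ α + β = γ ∧
    ∀ᵐ t ∂P.priorMeasure, IsSubexponential (P.sampling t) (fun y => P.observedInfo y t) α β

/-- `E λ_d(Σ)`, `E λ₁(Σ)⁻¹`, `E λ_d(I(θ))²` and `E λ₁(I(θ))⁻¹` are at most `B`, where `Σ` is the
posterior covariance given `R` replications.  The expectations are integrals of functions with
values in `[0, ∞]`, and `λ₁⁻¹ = ∞` for singular matrices. -/
def SpectralMomentsBounded (R : ℕ) (B : ℝ) : Prop :=
  ∫⁻ ys, ENNReal.ofReal (lamMax (P.posteriorCov ys)) ∂P.marginal R ≤ ENNReal.ofReal B ∧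
  ∫⁻ ys, (ENNReal.ofReal (lamMin (P.posteriorCov ys)))⁻¹ ∂P.marginal R ≤ ENNReal.ofReal B ∧
  ∫⁻ t, ENNReal.ofReal (lamMax (P.fisherInfo t) ^ 2) ∂P.priorMeasure ≤ ENNReal.ofReal B ∧
  ∫⁻ t, (ENNReal.ofReal (lamMin (P.fisherInfo t)))⁻¹ ∂P.priorMeasure ≤ ENNReal.ofReal B

/-- The conditional entropy `h(θ ∣ y⁽¹⁾, …, y⁽ⁿ⁾)`, the average entropy of the posteriors. -/
def condEntropy (n : ℕ) : ℝ :=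
  ∫ ys, diffEntropy (fun t => P.posteriorDensity (n := n) ys t) ∂P.marginal n

/-- The integrals in `condEntropy n` converge. -/
def CondEntropyFinite (n : ℕ) : Prop :=
  (∀ᵐ ys ∂P.marginal n,
    Integrable (fun t => Real.negMulLog (P.posteriorDensity (n := n) ys t))) ∧
  Integrable (fun ys => diffEntropy (fun t => P.posteriorDensity (n := n) ys t)) (P.marginal n)

/-- The conditional mutual information of `θ` and `M` replications given `R` further replications,
`h(θ ∣ ỹ_R) - h(θ ∣ ỹ_R, ȳ_M)`.  For `M = R = 1` it is `I(θ, y_rep ∣ y)`. -/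
def cmi (M R : ℕ) : ℝ := P.condEntropy R - P.condEntropy (R + M)

/-- `Σ^{1/2} I(θ) Σ^{1/2}` with `Σ` the posterior covariance given `R` replications, as a function
of `(θ, (y⁽¹⁾, …, y⁽ᴿ⁾))`. -/
def normalizedInfo (R : ℕ) (z : EuclideanSpace ℝ (Fin d) × (Fin R → Y)) :
    Matrix (Fin d) (Fin d) ℝ :=
  matSqrt (P.posteriorCov z.2) * P.fisherInfo z.1 * matSqrt (P.posteriorCov z.2)

end BayesModel

end

/-!
Two consecutive normal posteriors differ by the likelihood of one observation, so the normality of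
all late posteriors forces `log p(y ∣ ·)` to be a quadratic polynomial for almost every `y`, and the
prior to be normal (`BayesModel.ae_isQuadratic`, `BayesModel.exists_prior_eq`).  Hence the observed
information `A(y)` does not depend on `θ`, every posterior is normal, and its precision matrix is
`Λ = Q₀ + ∑ᵢ A(y⁽ⁱ⁾)`, where `Q₀` is the prior precision.  Since `Λ` is positive definite for any
number of replications, `A(y)` is positive semidefinite
(`BayesModel.IsNormalModel.ae_curvature_posSemidef`).

The entropy of a normal distribution turns conditional entropies into expectations of `log det Λ`,
and the information of one more replication into half the expectation of
`log det (Λ + A) - log det Λ` (`BayesModel.IsNormalModel.cmi_one_eq`).  This increment is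
nonnegative and antitone in `Λ` (`Matrix.PosDef.log_det_add_sub_antitone`), which gives
`I(1 ∣ R) ≤ I(1 ∣ 1)` and `I(1 ∣ R) ≤ I(M ∣ R)`, writing `I(M ∣ R)` for the information of `M`
replications given `R` others.

It remains to compare `I(1 ∣ R)` with the trace.  Both are of order `d`:

* The second moment bound `E[A² ∣ θ] ≼ γ` implies `I(θ) ≼ (1 + γ) / 2`, so the trace is at most
  `(1 + γ) / 2 · E tr Σ ≤ (1 + γ) / 2 · d B` (`BayesModel.IsNormalModel.normalizedInfo_bound`).
* If `Λ ≼ t⁻¹`, then `log det (Λ + A) - log det Λ ≥ log det (1 + t A) ≥ t tr A - t² tr A² / 2`.  By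
  Markov's inequality `Λ ≼ 4 B` and `tr I(θ) ≥ d / (4 B)` hold together with probability at least
  one half, and for a small `t` depending on `γ` and `B` the conditional expectation of the right
  side is then at least a constant times `d` (`BayesModel.IsNormalModel.le_cmi_one`).

In particular `I(1 ∣ R)` dominates the trace up to a constant.  The factor `log d` in the bound for
`M` replications pays for the division by `M`, which is of order `log d`.
-/

/-! ### Loewner order and log-determinants -/

section Matrices

variable {d : ℕ} {A P Q X Y : Matrix (Fin d) (Fin d) ℝ}

/-- Inversion reverses the Loewner order: both orderings express that the block matrix
`[[Q, 1], [1, P⁻¹]]` is positive semidefinite. -/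
lemma Matrix.PosDef.inv_sub_inv_posSemidef (hP : P.PosDef) (hQ : Q.PosDef)
    (h : (Q - P).PosSemidef) : (P⁻¹ - Q⁻¹).PosSemidef := by
  have := hP.inv.isUnit.invertible
  have := hQ.isUnit.invertible
  have h1 := Matrix.PosDef.fromBlocks₁₁ (1 : Matrix (Fin d) (Fin d) ℝ) P⁻¹ hQ
  have h2 := Matrix.PosDef.fromBlocks₂₂ Q (1 : Matrix (Fin d) (Fin d) ℝ) hP.inv
  have hPP : P⁻¹⁻¹ = P := Matrix.nonsing_inv_nonsing_inv _
    ((Matrix.isUnit_iff_isUnit_det _).1 hP.isUnit)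
  simp only [Matrix.conjTranspose_one, Matrix.one_mul, Matrix.mul_one, hPP] at h1 h2
  exact h1.1 (h2.2 h)

/-- The unitary diagonalization of a symmetric matrix. -/
lemma Matrix.IsHermitian.exists_diagonalization (hX : X.IsHermitian) :
    ∃ U V : Matrix (Fin d) (Fin d) ℝ, U * V = 1 ∧ V * U = 1 ∧
      X = U * Matrix.diagonal hX.eigenvalues * V := by
  refine ⟨hX.eigenvectorUnitary, star (hX.eigenvectorUnitary : Matrix (Fin d) (Fin d) ℝ), ?_, ?_,
    ?_⟩
  · exact Unitary.mul_star_self_of_mem hX.eigenvectorUnitary.2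
  · exact Unitary.star_mul_self_of_mem hX.eigenvectorUnitary.2
  · have := hX.spectral_theorem
    rw [Unitary.conjStarAlgAut_apply] at this
    exact this

lemma Matrix.IsHermitian.det_one_add (hX : X.IsHermitian) :
    (1 + X).det = ∏ i, (1 + hX.eigenvalues i) := by
  obtain ⟨U, V, hUV, hVU, h⟩ := hX.exists_diagonalization
  have h1 : 1 + X = U * Matrix.diagonal (fun i => 1 + hX.eigenvalues i) * V := by
    have : Matrix.diagonal (fun i => 1 + hX.eigenvalues i)
        = 1 + Matrix.diagonal hX.eigenvalues := by
      rw [← Matrix.diagonal_one, Matrix.diagonal_add]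
    rw [this, mul_add, add_mul, mul_one, hUV, ← h]
  rw [h1, Matrix.det_mul, Matrix.det_mul, Matrix.det_diagonal, mul_comm, ← mul_assoc,
    ← Matrix.det_mul, hVU, Matrix.det_one, one_mul]

lemma Matrix.IsHermitian.trace_sq (hX : X.IsHermitian) :
    (X * X).trace = ∑ i, hX.eigenvalues i ^ 2 := by
  obtain ⟨U, V, hUV, hVU, h⟩ := hX.exists_diagonalization
  set D := Matrix.diagonal hX.eigenvalues with hD
  have h1 : X * X = U * (D * D) * V := by
    rw [h]
    calc U * D * V * (U * D * V) = U * D * (V * U) * D * V := by simp only [mul_assoc]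
      _ = _ := by rw [hVU]; simp only [mul_assoc, mul_one]
  rw [h1, Matrix.trace_mul_comm, ← mul_assoc, hVU, one_mul, hD, Matrix.diagonal_mul_diagonal,
    Matrix.trace_diagonal]
  simp [sq]

lemma Matrix.PosSemidef.one_le_det_one_add (hX : X.PosSemidef) : 1 ≤ (1 + X).det := by
  rw [hX.1.det_one_add]
  refine Finset.prod_induction _ (fun r => (1 : ℝ) ≤ r) (fun a b ha hb => ?_) le_rfl
    fun i _ => by linarith [hX.eigenvalues_nonneg i]
  nlinarith

lemma Matrix.PosSemidef.trace_sub_le_log_det (hX : X.PosSemidef) :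
    X.trace - (X * X).trace / 2 ≤ Real.log (1 + X).det := by
  rw [hX.1.det_one_add, hX.1.trace_sq, hX.1.trace_eq_sum_eigenvalues, Real.log_prod]
  · rw [Finset.sum_div, ← Finset.sum_sub_distrib]
    refine Finset.sum_le_sum fun i _ => ?_
    simp only [RCLike.ofReal_real_eq_id, id_eq]
    set x := hX.1.eigenvalues i
    have h0 : 0 ≤ x := hX.eigenvalues_nonneg i
    have h1 : 2 * x / (x + 2) ≤ Real.log (1 + x) := Real.le_log_one_add_of_nonneg h0
    refine le_trans ?_ h1
    rw [le_div_iff₀ (by linarith)]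
    nlinarith [mul_nonneg h0 (mul_nonneg h0 h0)]
  · intro i _
    have := hX.eigenvalues_nonneg i
    positivity

lemma Matrix.PosDef.log_det_le_trace (hX : X.PosDef) : Real.log X.det ≤ X.trace := by
  rw [hX.1.det_eq_prod_eigenvalues, hX.1.trace_eq_sum_eigenvalues]
  simp only [RCLike.ofReal_real_eq_id, id_eq]
  rw [Real.log_prod fun i _ => (hX.eigenvalues_pos i).ne']
  exact Finset.sum_le_sum fun i _ => (Real.log_le_sub_one_of_pos (hX.eigenvalues_pos i)).trans
    (by linarith)

open scoped MatrixOrder in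
lemma matSqrt_posSemidef (A : Matrix (Fin d) (Fin d) ℝ) : (matSqrt A).PosSemidef :=
  Matrix.nonneg_iff_posSemidef.1 (CFC.sqrt_nonneg A)

open scoped MatrixOrder in
lemma matSqrt_mul_self (hA : A.PosSemidef) : matSqrt A * matSqrt A = A :=
  CFC.sqrt_mul_sqrt_self A (Matrix.nonneg_iff_posSemidef.2 hA)

lemma Matrix.PosSemidef.conj (hX : X.PosSemidef) (hY : Y.IsHermitian) :
    (Y * X * Y).PosSemidef := by
  have := hX.mul_mul_conjTranspose_same Y
  rwa [hY.eq] at this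

/-- `det (P + A) / det P = det (1 + A^{1/2} P⁻¹ A^{1/2})`. -/
lemma Matrix.PosDef.det_add_eq (hP : P.PosDef) (hA : A.PosSemidef) :
    (P + A).det = P.det * (1 + matSqrt A * P⁻¹ * matSqrt A).det := by
  have hu := (Matrix.isUnit_iff_isUnit_det _).1 hP.isUnit
  have h1 : P + A = P * (1 + P⁻¹ * matSqrt A * matSqrt A) := by
    rw [mul_add, mul_one, mul_assoc P⁻¹, matSqrt_mul_self hA, ← mul_assoc,
      Matrix.mul_nonsing_inv _ hu, one_mul]
  rw [h1, Matrix.det_mul, Matrix.det_one_add_mul_comm, mul_assoc]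

lemma Matrix.PosDef.det_le_det_add (hP : P.PosDef) (hA : A.PosSemidef) :
    P.det ≤ (P + A).det := by
  rw [hP.det_add_eq hA]
  exact le_mul_of_one_le_right hP.det_pos.le
    (hP.inv.posSemidef.conj (matSqrt_posSemidef A).1).one_le_det_one_add

lemma Matrix.PosDef.log_det_le_log_det_add (hP : P.PosDef) (hA : A.PosSemidef) :
    Real.log P.det ≤ Real.log (P + A).det :=
  Real.log_le_log hP.det_pos (hP.det_le_det_add hA)

/-- Diminishing returns for the log-determinant: the increment caused by adding `A` is the smaller,
the larger the matrix it is added to. -/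
lemma Matrix.PosDef.log_det_add_sub_antitone (hP : P.PosDef) (hQ : Q.PosDef)
    (hPQ : (Q - P).PosSemidef) (hA : A.PosSemidef) :
    Real.log (Q + A).det - Real.log Q.det ≤ Real.log (P + A).det - Real.log P.det := by
  have hS := (matSqrt_posSemidef A).1
  have key : ∀ {T : Matrix (Fin d) (Fin d) ℝ}, T.PosDef →
      Real.log (T + A).det - Real.log T.det
        = Real.log (1 + matSqrt A * T⁻¹ * matSqrt A).det := by
    intro T hT
    have := (hT.inv.posSemidef.conj hS).one_le_det_one_add
    rw [hT.det_add_eq hA, Real.log_mul hT.det_pos.ne' (by linarith)]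
    ring
  rw [key hP, key hQ]
  have hinv := (hP.inv_sub_inv_posSemidef hQ hPQ).conj hS
  have h1 : (1 + matSqrt A * Q⁻¹ * matSqrt A).PosDef :=
    Matrix.PosDef.one.add_posSemidef (hQ.inv.posSemidef.conj hS)
  have h2 := h1.log_det_le_log_det_add hinv
  have h3 : 1 + matSqrt A * Q⁻¹ * matSqrt A + matSqrt A * (P⁻¹ - Q⁻¹) * matSqrt A
      = 1 + matSqrt A * P⁻¹ * matSqrt A := by
    rw [mul_sub, sub_mul]; abel
  rwa [h3] at h2

/-- If `P ≤ t⁻¹`, adding `A` to `P` increases the log-determinant by at least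
`log det (1 + t A) ≥ t tr A - t² tr A² / 2`. -/
lemma Matrix.PosDef.le_log_det_add_sub {t : ℝ} (ht : 0 < t) (hP : P.PosDef)
    (h : (t⁻¹ • (1 : Matrix (Fin d) (Fin d) ℝ) - P).PosSemidef) (hA : A.PosSemidef) :
    t * A.trace - t ^ 2 / 2 * (A * A).trace ≤ Real.log (P + A).det - Real.log P.det := by
  have ht' : 0 < t⁻¹ := inv_pos.2 ht
  have hQ : (t⁻¹ • (1 : Matrix (Fin d) (Fin d) ℝ)).PosDef := Matrix.PosDef.one.smul ht'
  refine le_trans ?_ (hP.log_det_add_sub_antitone hQ h hA)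
  have htA : (t • A).PosSemidef := hA.smul ht.le
  have h1 : t⁻¹ • (1 : Matrix (Fin d) (Fin d) ℝ) + A = t⁻¹ • (1 + t • A) := by
    rw [smul_add, smul_smul, inv_mul_cancel₀ ht.ne', one_smul]
  have h2 := htA.trace_sub_le_log_det
  have h3 := htA.one_le_det_one_add
  rw [h1, Matrix.det_smul, Matrix.det_smul, Matrix.det_one, mul_one,
    Real.log_mul (by positivity) (by linarith), add_sub_cancel_left]
  refine le_trans (le_of_eq ?_) h2
  simp only [Matrix.trace_smul, Matrix.smul_mul, Matrix.mul_smul, smul_eq_mul]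
  ring

lemma Matrix.IsHermitian.lamMin_le_eigenvalues (hX : X.IsHermitian) (i : Fin d) :
    lamMin X ≤ hX.eigenvalues i := by
  unfold lamMin
  rw [hX.spectrum_real_eq_range_eigenvalues]
  exact csInf_le (Set.finite_range _).bddBelow ⟨i, rfl⟩

lemma Matrix.IsHermitian.eigenvalues_le_lamMax (hX : X.IsHermitian) (i : Fin d) :
    hX.eigenvalues i ≤ lamMax X := by
  unfold lamMax
  rw [hX.spectrum_real_eq_range_eigenvalues]
  exact le_csSup (Set.finite_range _).bddAbove ⟨i, rfl⟩

lemma Matrix.IsHermitian.lamMin_mul_le_trace (hX : X.IsHermitian) :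
    d * lamMin X ≤ X.trace := by
  rw [hX.trace_eq_sum_eigenvalues]
  simpa using Finset.card_nsmul_le_sum Finset.univ (fun i => hX.eigenvalues i) _
    fun i _ => hX.lamMin_le_eigenvalues i

lemma Matrix.IsHermitian.trace_le_mul_lamMax (hX : X.IsHermitian) :
    X.trace ≤ d * lamMax X := by
  rw [hX.trace_eq_sum_eigenvalues]
  simpa using Finset.sum_le_card_nsmul Finset.univ (fun i => hX.eigenvalues i) _
    fun i _ => hX.eigenvalues_le_lamMax i

lemma Matrix.IsHermitian.sub_smul_one_posSemidef (hX : X.IsHermitian) {s : ℝ}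
    (hs : s ≤ lamMin X) : (X - s • (1 : Matrix (Fin d) (Fin d) ℝ)).PosSemidef := by
  have h1 : X - s • (1 : Matrix (Fin d) (Fin d) ℝ)
      = (hX.eigenvectorUnitary : Matrix (Fin d) (Fin d) ℝ)
        * Matrix.diagonal (fun i => hX.eigenvalues i - s)
        * (hX.eigenvectorUnitary : Matrix (Fin d) (Fin d) ℝ).conjTranspose := by
    have h2 : Matrix.diagonal (fun i => hX.eigenvalues i - s)
        = Matrix.diagonal hX.eigenvalues - s • 1 := by
      rw [← Matrix.diagonal_one, ← Matrix.diagonal_smul, Matrix.diagonal_sub]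
      simp
    have h3 := hX.spectral_theorem
    rw [Unitary.conjStarAlgAut_apply] at h3
    have h4 := Unitary.mul_star_self_of_mem hX.eigenvectorUnitary.2
    rw [h2, mul_sub, sub_mul, Matrix.mul_smul, Matrix.smul_mul, mul_one]
    rw [Matrix.star_eq_conjTranspose] at h3 h4
    rw [h4]
    congr 1
  rw [h1]
  refine Matrix.PosSemidef.mul_mul_conjTranspose_same (.diagonal fun i => ?_) _
  have := hX.lamMin_le_eigenvalues i
  simp only [Pi.zero_apply]
  linarith

lemma Matrix.PosSemidef.abs_apply_le_trace (hX : X.PosSemidef) (i j : Fin d) :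
    |X i j| ≤ X.trace := by
  have hdiag : ∀ k, X k k ≤ X.trace := fun k =>
    Finset.single_le_sum (f := fun k => X k k) (fun l _ => hX.diag_nonneg) (Finset.mem_univ k)
  have hsym : X j i = X i j := by simpa using hX.1.apply i j
  have h1 := hX.dotProduct_mulVec_nonneg (Pi.single i 1 + Pi.single j 1)
  have h2 := hX.dotProduct_mulVec_nonneg (Pi.single i 1 - Pi.single j 1)
  simp [Matrix.mulVec_add, Matrix.mulVec_sub, add_dotProduct, sub_dotProduct] at h1 h2
  rw [abs_le]
  constructor <;> linarith [hdiag i, hdiag j]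

/-- For positive semidefinite `Q` and symmetric `X`, from `(X - 1)² ≥ 0`. -/
lemma Matrix.PosSemidef.two_mul_trace_mul_le (hQ : Q.PosSemidef) (hX : X.IsHermitian) :
    2 * (Q * X).trace ≤ Q.trace + (Q * (X * X)).trace := by
  have h : (matSqrt Q * ((X - 1) * (X - 1)) * matSqrt Q).PosSemidef := by
    refine Matrix.PosSemidef.conj ?_ (matSqrt_posSemidef Q).1
    have := Matrix.posSemidef_conjTranspose_mul_self (X - 1)
    rwa [Matrix.conjTranspose_sub, hX.eq, Matrix.conjTranspose_one] at this
  have h1 := h.trace_nonneg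
  rw [Matrix.trace_mul_comm, ← mul_assoc, matSqrt_mul_self hQ] at h1
  have h2 : Q * ((X - 1) * (X - 1)) = Q - Q * X - Q * X + Q * (X * X) := by noncomm_ring
  rw [h2, Matrix.trace_add, Matrix.trace_sub, Matrix.trace_sub] at h1
  linarith

lemma Matrix.PosSemidef.trace_mul_nonneg (hQ : Q.PosSemidef) (hX : X.PosSemidef) :
    0 ≤ (Q * X).trace := by
  have := (hX.conj (matSqrt_posSemidef Q).1).trace_nonneg
  rwa [Matrix.trace_mul_comm, ← mul_assoc, matSqrt_mul_self hQ] at this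

end Matrices

/-! ### Densities on finite products -/

lemma lintegral_pi_prod {n : ℕ} {Y : Fin n → Type*} [∀ i, MeasurableSpace (Y i)]
    (μ : ∀ i, Measure (Y i)) [∀ i, SigmaFinite (μ i)] {f : ∀ i, Y i → ℝ≥0∞}
    (hf : ∀ i, Measurable (f i)) :
    ∫⁻ x, ∏ i, f i (x i) ∂Measure.pi μ = ∏ i, ∫⁻ x, f i x ∂μ i := by
  induction n with
  | zero => simp
  | succ n ih =>
    have hmp := (measurePreserving_piFinSuccAbove μ 0).symm
    rw [← hmp.lintegral_comp_emb (MeasurableEquiv.measurableEmbedding _), lintegral_prod]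
    · simp only [Fin.prod_univ_succ, MeasurableEquiv.piFinSuccAbove_symm_apply,
        Fin.insertNthEquiv_zero]
      have h1 : ∀ x : Y 0, ∫⁻ z, f 0 x * ∏ i : Fin n, f i.succ (z i)
          ∂Measure.pi (fun i : Fin n => μ i.succ)
            = f 0 x * ∏ i : Fin n, ∫⁻ y, f i.succ y ∂μ i.succ := by
        intro x
        rw [lintegral_const_mul, ih (fun i => μ i.succ) fun i => hf i.succ]
        exact Finset.measurable_prod _ fun i _ => (hf _).comp (measurable_pi_apply i)
      have h2 := lintegral_mul_const (μ := μ 0) (∏ i : Fin n, ∫⁻ y, f i.succ y ∂μ i.succ) (hf 0)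
      rw [← h2]
      exact lintegral_congr h1
    · refine Measurable.aemeasurable ?_
      have : Measurable fun x : ∀ i, Y i => ∏ i, f i (x i) :=
        Finset.measurable_prod _ fun i _ => (hf _).comp (measurable_pi_apply i)
      exact this.comp (MeasurableEquiv.measurable _)

/-- A product of measures with densities has the product density. -/
lemma pi_withDensity {n : ℕ} {Y : Fin n → Type*} [∀ i, MeasurableSpace (Y i)]
    (μ : ∀ i, Measure (Y i)) [∀ i, SigmaFinite (μ i)] {f : ∀ i, Y i → ℝ≥0∞}
    (hf : ∀ i, Measurable (f i)) [∀ i, SigmaFinite ((μ i).withDensity (f i))] :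
    Measure.pi (fun i => (μ i).withDensity (f i))
      = (Measure.pi μ).withDensity fun x => ∏ i, f i (x i) := by
  refine Measure.pi_eq fun s hs => ?_
  rw [withDensity_apply _ (MeasurableSet.univ_pi hs), ← lintegral_indicator (MeasurableSet.univ_pi hs)]
  have h1 : (fun x => (Set.univ.pi s).indicator (fun x => ∏ i, f i (x i)) x)
      = fun x : ∀ i, Y i => ∏ i, (s i).indicator (f i) (x i) := by
    ext x
    by_cases hx : x ∈ Set.univ.pi s
    · rw [Set.indicator_of_mem hx]
      exact Finset.prod_congr rfl fun i _ => (Set.indicator_of_mem (hx i trivial) _).symm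
    · rw [Set.indicator_of_notMem hx]
      simp only [Set.mem_pi, not_forall] at hx
      obtain ⟨i, _, hi⟩ := hx
      exact (Finset.prod_eq_zero (Finset.mem_univ i) (Set.indicator_of_notMem hi _)).symm
  rw [h1, lintegral_pi_prod μ fun i => (hf i).indicator (hs i)]
  refine Finset.prod_congr rfl fun i _ => ?_
  rw [lintegral_indicator (hs i), withDensity_apply _ (hs i)]

/-! ### Quadratic exponents and multivariate normal distributions -/

/-- The quadratic polynomial `c + ⟨b, t⟩ - ⟨t, Q t⟩ / 2`. -/
noncomputable def quadFun {d : ℕ} (c : ℝ) (b : Fin d → ℝ) (Q : Matrix (Fin d) (Fin d) ℝ)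
    (t : EuclideanSpace ℝ (Fin d)) : ℝ :=
  c + b ⬝ᵥ t.ofLp - (t.ofLp ⬝ᵥ Q.mulVec t.ofLp) / 2

section Quadratic

variable {d : ℕ}

lemma continuous_quadFun (c : ℝ) (b : Fin d → ℝ) (Q : Matrix (Fin d) (Fin d) ℝ) :
    Continuous (quadFun c b Q) := by
  unfold quadFun
  simp only [dotProduct, Matrix.mulVec]
  fun_prop

lemma stdGaussian_eq_withDensity :
    stdGaussian (EuclideanSpace ℝ (Fin d)) = volume.withDensity fun t =>
      ENNReal.ofReal (Real.exp (quadFun (-(d / 2 * Real.log (2 * Real.pi))) 0 1 t)) := by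
  rw [← map_pi_eq_stdGaussian]
  have h1 : gaussianReal 0 1 = volume.withDensity (gaussianPDF 0 1) :=
    gaussianReal_of_var_ne_zero 0 one_ne_zero
  have : SigmaFinite ((volume : Measure ℝ).withDensity (gaussianPDF 0 1)) := by
    rw [← h1]; infer_instance
  rw [h1, pi_withDensity _ fun i => measurable_gaussianPDF 0 1]
  have hmp := PiLp.volume_preserving_toLp (Fin d)
  have he : MeasurableEmbedding (WithLp.toLp 2 : (Fin d → ℝ) → EuclideanSpace ℝ (Fin d)) :=
    (MeasurableEquiv.toLp 2 (Fin d → ℝ)).measurableEmbedding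
  ext s hs
  rw [Measure.map_apply he.measurable hs, withDensity_apply _ (he.measurable hs),
    withDensity_apply _ hs, ← hmp.setLIntegral_comp_preimage_emb he]
  refine lintegral_congr fun x => ?_
  simp only [gaussianPDF]
  rw [← ENNReal.ofReal_prod_of_nonneg fun i _ => gaussianPDFReal_nonneg _ _ _]
  congr 1
  simp only [gaussianPDFReal, quadFun]
  rw [Finset.prod_mul_distrib, ← Real.exp_sum, Finset.prod_const, sub_eq_add_neg, zero_dotProduct,
    add_zero, Real.exp_add, Matrix.one_mulVec]
  congr 1
  · rw [NNReal.coe_one, mul_one, Finset.card_univ, Fintype.card_fin, ← Real.exp_log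
      (show 0 < (√(2 * Real.pi))⁻¹ by positivity), ← Real.exp_nat_mul, Real.log_inv,
      Real.log_sqrt (by positivity)]
    ring_nf
  · simp [dotProduct, sq, Finset.sum_div, neg_div]

lemma det_toEuclideanCLM (A : Matrix (Fin d) (Fin d) ℝ) :
    (Matrix.toEuclideanCLM (𝕜 := ℝ) A).det = A.det := by
  rw [ContinuousLinearMap.det, Matrix.coe_toEuclideanCLM_eq_toEuclideanLin]
  rw [Matrix.toEuclideanLin_eq_toLin_orthonormal, LinearMap.det_toLin]

lemma dotProduct_mulVec_comm {Q : Matrix (Fin d) (Fin d) ℝ} (hQ : Q.IsHermitian)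
    (x y : Fin d → ℝ) : x ⬝ᵥ Q.mulVec y = y ⬝ᵥ Q.mulVec x := by
  rw [Matrix.dotProduct_mulVec, dotProduct_comm, ← Matrix.mulVec_transpose]
  congr 2

/-- Completing the square. -/
lemma quadFun_add {Q : Matrix (Fin d) (Fin d) ℝ} (hQ : Q.IsHermitian) (c : ℝ)
    (m x : EuclideanSpace ℝ (Fin d)) :
    quadFun c (Q.mulVec m.ofLp) Q (m + x)
      = c + (m.ofLp ⬝ᵥ Q.mulVec m.ofLp) / 2 - (x.ofLp ⬝ᵥ Q.mulVec x.ofLp) / 2 := by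
  have h := dotProduct_mulVec_comm hQ m.ofLp x.ofLp
  simp only [quadFun, WithLp.ofLp_add, Matrix.mulVec_add, dotProduct_add, add_dotProduct]
  rw [dotProduct_comm (Q.mulVec m.ofLp), dotProduct_comm (Q.mulVec m.ofLp), h]
  ring

/-- The density of a nondegenerate multivariate normal distribution. -/
lemma multivariateGaussian_eq_withDensity {S : Matrix (Fin d) (Fin d) ℝ} (hS : S.PosDef)
    (m : EuclideanSpace ℝ (Fin d)) :
    multivariateGaussian m S = volume.withDensity fun t => ENNReal.ofReal (Real.exp (quadFun
      (-(d / 2 * Real.log (2 * Real.pi)) - Real.log S.det / 2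
        - (m.ofLp ⬝ᵥ S⁻¹.mulVec m.ofLp) / 2) (S⁻¹.mulVec m.ofLp) S⁻¹ t)) := by
  set r := matSqrt S with hr
  have hrr : r * r = S := matSqrt_mul_self hS.posSemidef
  have hrS : r.IsHermitian := (matSqrt_posSemidef S).1
  have hdetS : r.det * r.det = S.det := by rw [← Matrix.det_mul, hrr]
  have hdet0 : r.det ≠ 0 := fun h => hS.det_pos.ne' (by rw [← hdetS, h, mul_zero])
  have hdet : 0 < r.det := lt_of_le_of_ne (matSqrt_posSemidef S).det_nonneg hdet0.symm
  have hu : IsUnit r.det := hdet0.isUnit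
  have hrSr : r * S⁻¹ * r = 1 := by
    rw [← hrr, Matrix.mul_inv_rev, ← mul_assoc, Matrix.mul_nonsing_inv _ hu, one_mul,
      Matrix.nonsing_inv_mul _ hu]
  have hlog : r.det = Real.exp (Real.log S.det / 2) := by
    rw [← hdetS, Real.log_mul hdet0 hdet0, add_self_div_two, Real.exp_log hdet]
  set T := Matrix.toEuclideanCLM (𝕜 := ℝ) r with hT
  have hTdet : T.det = r.det := det_toEuclideanCLM r
  have hTof : ∀ x, (T x).ofLp = r.mulVec x.ofLp := fun x => Matrix.ofLp_toEuclideanCLM r x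
  have hTinj : Function.Injective T := by
    intro x y hxy
    have h1 : r.mulVec x.ofLp = r.mulVec y.ofLp := by rw [← hTof, ← hTof, hxy]
    have h2 := congrArg (r⁻¹.mulVec) h1
    rw [Matrix.mulVec_mulVec, Matrix.mulVec_mulVec, Matrix.nonsing_inv_mul _ hu,
      Matrix.one_mulVec, Matrix.one_mulVec] at h2
    exact (WithLp.ofLp_injective 2) h2
  have hTsurj : Function.Surjective T := by
    intro y
    refine ⟨WithLp.toLp 2 (r⁻¹.mulVec y.ofLp), WithLp.ofLp_injective 2 ?_⟩
    rw [hTof, Matrix.mulVec_mulVec, Matrix.mul_nonsing_inv _ hu, Matrix.one_mulVec]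
  have hFinj : Function.Injective fun x => m + T x :=
    fun x y hxy => hTinj (add_left_cancel hxy)
  have hFsurj : Function.Surjective fun x => m + T x := fun y =>
    (hTsurj (y - m)).imp fun x hx => by simp [hx]
  have hFm : Measurable fun x => m + T x := by fun_prop
  have hdef : multivariateGaussian m S
      = (stdGaussian (EuclideanSpace ℝ (Fin d))).map fun x => m + T x := rfl
  ext s hs
  rw [hdef, Measure.map_apply hFm hs, stdGaussian_eq_withDensity,
    withDensity_apply _ (hFm hs), withDensity_apply _ hs]
  conv_rhs => rw [← Set.image_preimage_eq s hFsurj]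
  rw [lintegral_image_eq_lintegral_abs_det_fderiv_mul volume (hFm hs)
    (f' := fun _ => T) (fun x _ => (T.hasFDerivAt.const_add m).hasFDerivWithinAt) hFinj.injOn]
  refine lintegral_congr fun x => ?_
  rw [hTdet, abs_of_pos hdet, hlog, ← ENNReal.ofReal_mul (Real.exp_pos _).le, ← Real.exp_add,
    quadFun_add hS.inv.1, hTof]
  have h3 : r.mulVec x.ofLp ⬝ᵥ S⁻¹.mulVec (r.mulVec x.ofLp) = x.ofLp ⬝ᵥ x.ofLp := by
    have : r.mulVec x.ofLp = Matrix.vecMul x.ofLp r := by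
      conv_rhs => rw [← hrS.eq]
      rw [Matrix.vecMul_conjTranspose]
      simp
    conv_lhs => rw [this]
    rw [← Matrix.dotProduct_mulVec, Matrix.mulVec_mulVec, ← this, Matrix.mulVec_mulVec,
      hrSr, Matrix.one_mulVec]
  rw [h3]
  simp only [quadFun, Matrix.one_mulVec, zero_dotProduct]
  congr 2
  ring

/-- A Gaussian measure on `ℝ^d` that is absolutely continuous is nondegenerate. -/
lemma exists_eq_multivariateGaussian {μ : Measure (EuclideanSpace ℝ (Fin d))} [IsGaussian μ]
    (hμ : μ ≪ volume) : ∃ (m : EuclideanSpace ℝ (Fin d)) (S : Matrix (Fin d) (Fin d) ℝ),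
      S.PosDef ∧ μ = multivariateGaussian m S := by
  set S : Matrix (Fin d) (Fin d) ℝ := Matrix.of fun i j =>
    covarianceBilin μ (EuclideanSpace.basisFun (Fin d) ℝ i) (EuclideanSpace.basisFun (Fin d) ℝ j)
    with hSdef
  have hbil : ∀ x y, covarianceBilin μ x y = x.ofLp ⬝ᵥ S.mulVec y.ofLp := by
    intro x y
    conv_lhs => rw [← (EuclideanSpace.basisFun (Fin d) ℝ).sum_repr x,
      ← (EuclideanSpace.basisFun (Fin d) ℝ).sum_repr y]
    simp only [map_sum, map_smul, sum_apply, smul_apply,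
      smul_eq_mul, dotProduct, Matrix.mulVec, hSdef, Matrix.of_apply,
      EuclideanSpace.basisFun_repr, Finset.mul_sum]
    rw [Finset.sum_comm]
    refine Finset.sum_congr rfl fun i _ => Finset.sum_congr rfl fun j _ => ?_
    ring
  have hSpsd : S.PosSemidef := by
    refine .of_dotProduct_mulVec_nonneg ?_ fun x => ?_
    · ext i j
      simp [hSdef, covarianceBilin_comm]
    · have := covarianceBilin_self_nonneg (μ := μ) (WithLp.toLp 2 x)
      rw [hbil] at this
      simpa using this
  have heq : μ = multivariateGaussian (μ[id]) S := by
    refine IsGaussian.ext ?_ ?_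
    · rw [integral_id_multivariateGaussian']
    · ext x y
      rw [covarianceBilin_multivariateGaussian hSpsd, hbil]
  refine ⟨μ[id], S, hSpsd.posDef_iff_det_ne_zero.2 fun hdet => ?_, heq⟩
  -- a singular covariance would concentrate `μ` on a translate of the range of `S^{1/2}`
  set m := μ[id]
  set T := Matrix.toEuclideanCLM (𝕜 := ℝ) (matSqrt S) with hT
  have hTdet : T.det = 0 := by
    rw [det_toEuclideanCLM]
    have : (matSqrt S).det * (matSqrt S).det = 0 := by
      rw [← Matrix.det_mul, matSqrt_mul_self hSpsd, hdet]
    simpa using this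
  have h0 : volume (Set.range fun x => m + T x) = 0 := by
    have h1 : Set.range (fun x => m + T x) = (fun x => m + x) '' (T '' Set.univ) := by
      rw [Set.image_univ, ← Set.range_comp]; rfl
    have hle : LinearMap.range (T : EuclideanSpace ℝ (Fin d) →ₗ[ℝ] EuclideanSpace ℝ (Fin d)) ≠ ⊤ := by
      intro htop
      have hu := (LinearMap.isUnit_iff_range_eq_top _).2 htop
      have := (LinearMap.isUnit_iff_isUnit_det _).1 hu
      rw [ContinuousLinearMap.det] at hTdet
      rw [hTdet] at this
      exact not_isUnit_zero this
    rw [h1, Set.image_add_left, measure_preimage_add, Set.image_univ]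
    exact Measure.addHaar_submodule volume _ hle
  have h1 := hμ h0
  have h2 : (1 : ℝ≥0∞) ≤ μ (Set.range fun x => m + T x) := by
    have hF : Measurable fun x => m + T x := by fun_prop
    calc (1 : ℝ≥0∞) = stdGaussian (EuclideanSpace ℝ (Fin d))
          ((fun x => m + T x) ⁻¹' Set.range fun x => m + T x) := by
            rw [Set.preimage_range, measure_univ]
      _ ≤ (stdGaussian (EuclideanSpace ℝ (Fin d))).map (fun x => m + T x) _ :=
        Measure.le_map_apply hF.aemeasurable _
      _ = multivariateGaussian m S _ := rfl
      _ = μ _ := by rw [← heq]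
  rw [h1] at h2
  simp at h2

/-- A quadratic exponent whose exponential is integrable is strictly concave: along a direction `v`
with `⟨v, Q v⟩ ≤ 0` the mass of the unit ball would be bounded by the mass of its two translates by
`± s v`, which vanishes as `s → ∞`. -/
lemma posDef_of_lintegral_exp_quadFun_ne_top {c : ℝ} {b : Fin d → ℝ}
    {Q : Matrix (Fin d) (Fin d) ℝ} (hQ : Q.IsHermitian)
    (h : ∫⁻ t, ENNReal.ofReal (Real.exp (quadFun c b Q t)) ≠ ∞) : Q.PosDef := by
  refine .of_dotProduct_mulVec_pos hQ fun v hv => ?_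
  rw [star_trivial]
  by_contra! hneg
  set g : EuclideanSpace ℝ (Fin d) → ℝ≥0∞ := fun t =>
    ENNReal.ofReal (Real.exp (quadFun c b Q t)) with hg
  have hgm : Measurable g := by
    have := (continuous_quadFun c b Q).measurable
    fun_prop
  set V : EuclideanSpace ℝ (Fin d) := WithLp.toLp 2 v with hV
  have hV0 : 0 < ‖V‖ := by
    rw [norm_pos_iff]
    intro h0
    exact hv (congrArg WithLp.ofLp h0)
  have hpt : ∀ (s : ℝ) t, g t ≤ g (t + s • V) + g (t + (-s) • V) := by
    intro s t
    have h1 : 2 * quadFun c b Q t ≤ quadFun c b Q (t + s • V) + quadFun c b Q (t + (-s) • V) := by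
      simp only [quadFun, WithLp.ofLp_add, WithLp.ofLp_smul, hV, dotProduct_add, add_dotProduct,
        Matrix.mulVec_add, Matrix.mulVec_smul, dotProduct_smul, smul_dotProduct, smul_eq_mul]
      nlinarith [mul_nonneg (sq_nonneg s) (neg_nonneg.2 hneg)]
    rcases le_total (quadFun c b Q (t + s • V)) (quadFun c b Q (t + (-s) • V)) with h2 | h2
    · refine le_trans ?_ le_add_self
      exact ENNReal.ofReal_le_ofReal (Real.exp_le_exp.2 (by linarith))
    · refine le_trans ?_ le_self_add
      exact ENNReal.ofReal_le_ofReal (Real.exp_le_exp.2 (by linarith))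
  set μ := (volume : Measure (EuclideanSpace ℝ (Fin d))).withDensity g with hμ
  have hfin : IsFiniteMeasure μ := isFiniteMeasure_withDensity h
  set B : Set (EuclideanSpace ℝ (Fin d)) := Metric.ball 0 1
  set C : ℕ → Set (EuclideanSpace ℝ (Fin d)) := fun n => (Metric.ball 0 n)ᶜ with hC
  have hCm : ∀ n, MeasurableSet (C n) := fun n => measurableSet_ball.compl
  have htend : Tendsto (fun n => μ (C n)) atTop (nhds 0) := by
    have h1 := tendsto_measure_iInter_atTop (μ := μ) (s := C)
      (fun n => (hCm n).nullMeasurableSet)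
      (fun n m hnm => Set.compl_subset_compl.2 (Metric.ball_subset_ball (by exact_mod_cast hnm)))
      ⟨0, measure_ne_top _ _⟩
    have h2 : ⋂ n, C n = ∅ := by
      rw [hC, ← Set.compl_iUnion, Metric.iUnion_ball_nat, Set.compl_univ]
    rwa [h2, measure_empty] at h1
  have hshift : ∀ (n : ℕ) (s : ℝ), n + 1 ≤ |s| * ‖V‖ → ∫⁻ t in B, g (t + s • V) ≤ μ (C n) := by
    intro n s hs
    calc ∫⁻ t in B, g (t + s • V) = ∫⁻ t, B.indicator (fun t => g (t + s • V)) t :=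
          (lintegral_indicator measurableSet_ball _).symm
      _ ≤ ∫⁻ t, (C n).indicator g (t + s • V) := by
          refine lintegral_mono fun t => ?_
          by_cases ht : t ∈ B
          · have hmem : t + s • V ∈ C n := by
              simp only [hC, Set.mem_compl_iff, Metric.mem_ball, dist_zero_right, not_lt]
              have h1 : ‖t‖ < 1 := by simpa [B] using ht
              have h2 : ‖s • V‖ ≤ ‖t + s • V‖ + ‖t‖ := by
                have := norm_sub_le (t + s • V) t
                rwa [add_sub_cancel_left] at this
              rw [norm_smul, Real.norm_eq_abs] at h2
              linarith
            rw [Set.indicator_of_mem ht, Set.indicator_of_mem hmem]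
          · rw [Set.indicator_of_notMem ht]
            exact zero_le
      _ = ∫⁻ t, (C n).indicator g t := lintegral_add_right_eq_self _ _
      _ = μ (C n) := by
          rw [lintegral_indicator (hCm n), hμ, withDensity_apply _ (hCm n)]
  have hle : ∀ n : ℕ, ∫⁻ t in B, g t ≤ μ (C n) + μ (C n) := by
    intro n
    set s : ℝ := (n + 1) / ‖V‖ with hs
    have hs0 : 0 ≤ s := by positivity
    have hsV : s * ‖V‖ = n + 1 := div_mul_cancel₀ _ hV0.ne'
    calc ∫⁻ t in B, g t ≤ ∫⁻ t in B, (g (t + s • V) + g (t + (-s) • V)) :=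
          lintegral_mono fun t => hpt s t
      _ = (∫⁻ t in B, g (t + s • V)) + ∫⁻ t in B, g (t + (-s) • V) :=
          lintegral_add_left (by fun_prop) _
      _ ≤ _ := add_le_add (hshift n s (by rw [abs_of_nonneg hs0, hsV]))
          (hshift n (-s) (by rw [abs_neg, abs_of_nonneg hs0, hsV]))
  have hzero : ∫⁻ t in B, g t ≤ 0 := by
    have := ge_of_tendsto' (htend.add htend) hle
    rwa [add_zero] at this
  have hpos : 0 < ∫⁻ t in B, g t := by
    rw [setLIntegral_pos_iff hgm]
    have : Function.support g = Set.univ := by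
      ext t
      simp [hg, Real.exp_pos]
    rw [this, Set.univ_inter]
    exact Metric.measure_ball_pos _ _ one_pos
  exact absurd hzero (not_le.2 hpos)

/-- Normalization identifies a Gaussian density with a quadratic exponent. -/
lemma withDensity_exp_quadFun {c : ℝ} {b : Fin d → ℝ} {Q : Matrix (Fin d) (Fin d) ℝ}
    (hQ : Q.PosDef) (h : ∫⁻ t, ENNReal.ofReal (Real.exp (quadFun c b Q t)) = 1) :
    c = -(d / 2 * Real.log (2 * Real.pi)) + Real.log Q.det / 2 - (b ⬝ᵥ Q⁻¹.mulVec b) / 2 ∧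
    volume.withDensity (fun t => ENNReal.ofReal (Real.exp (quadFun c b Q t)))
      = multivariateGaussian (WithLp.toLp 2 (Q⁻¹.mulVec b)) Q⁻¹ := by
  have hu : IsUnit Q.det := (Matrix.isUnit_iff_isUnit_det _).1 hQ.isUnit
  have hG := multivariateGaussian_eq_withDensity hQ.inv (WithLp.toLp 2 (Q⁻¹.mulVec b))
  rw [Matrix.nonsing_inv_nonsing_inv _ hu] at hG
  simp only [Matrix.mulVec_mulVec, Matrix.mul_nonsing_inv _ hu, Matrix.one_mulVec] at hG
  rw [Matrix.det_nonsing_inv, Ring.inverse_eq_inv', Real.log_inv, dotProduct_comm] at hG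
  set c' := -(d / 2 * Real.log (2 * Real.pi)) - -Real.log Q.det / 2 - (b ⬝ᵥ Q⁻¹.mulVec b) / 2
    with hc'
  have hsplit : ∀ t, ENNReal.ofReal (Real.exp (quadFun c' b Q t))
      = ENNReal.ofReal (Real.exp (c' - c)) * ENNReal.ofReal (Real.exp (quadFun c b Q t)) := by
    intro t
    rw [← ENNReal.ofReal_mul (Real.exp_pos _).le, ← Real.exp_add]
    congr 2
    simp only [quadFun]
    ring
  have hcc : c' = c := by
    have h1 : multivariateGaussian (WithLp.toLp 2 (Q⁻¹.mulVec b)) Q⁻¹ Set.univ = 1 := measure_univ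
    rw [hG, withDensity_apply _ MeasurableSet.univ, Measure.restrict_univ, lintegral_congr hsplit,
      lintegral_const_mul' _ _ ENNReal.ofReal_ne_top, h, mul_one, ENNReal.ofReal_eq_one,
      Real.exp_eq_one_iff] at h1
    linarith
  refine ⟨by rw [← hcc, hc']; ring, by rw [hG, hcc]⟩

lemma covariance_exp_quadFun {c : ℝ} {b : Fin d → ℝ} {Q : Matrix (Fin d) (Fin d) ℝ}
    (hQ : Q.PosDef) (h : ∫⁻ t, ENNReal.ofReal (Real.exp (quadFun c b Q t)) = 1) :
    Matrix.of (fun i j => covariance (fun t => t i) (fun t => t j)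
      (volume.withDensity fun t => ENNReal.ofReal (Real.exp (quadFun c b Q t)))) = Q⁻¹ := by
  ext i j
  rw [(withDensity_exp_quadFun hQ h).2, Matrix.of_apply,
    covariance_eval_multivariateGaussian hQ.inv.posSemidef]

/-- The differential entropy of a nondegenerate normal distribution with precision matrix `Q`. -/
lemma entropy_exp_quadFun {c : ℝ} {b : Fin d → ℝ} {Q : Matrix (Fin d) (Fin d) ℝ}
    (hQ : Q.PosDef) (h : ∫⁻ t, ENNReal.ofReal (Real.exp (quadFun c b Q t)) = 1) :
    Integrable (fun t => Real.negMulLog (Real.exp (quadFun c b Q t))) ∧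
    diffEntropy (fun t => Real.exp (quadFun c b Q t))
      = d / 2 * (Real.log (2 * Real.pi) + 1) - Real.log Q.det / 2 := by
  obtain ⟨hc, hG⟩ := withDensity_exp_quadFun hQ h
  set m : EuclideanSpace ℝ (Fin d) := WithLp.toLp 2 (Q⁻¹.mulVec b) with hm
  set G := multivariateGaussian m Q⁻¹ with hGdef
  have hu : IsUnit Q.det := (Matrix.isUnit_iff_isUnit_det _).1 hQ.isUnit
  have hmem : ∀ i, MemLp (fun t : EuclideanSpace ℝ (Fin d) => t i) 2 G := fun i =>
    IsGaussian.memLp_dual G (EuclideanSpace.proj i) 2 (by simp)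
  have hmean : ∀ i, ∫ t, t i ∂G = m i := by
    intro i
    have := ContinuousLinearMap.integral_comp_id_comm (IsGaussian.integrable_id (μ := G))
      (EuclideanSpace.proj (𝕜 := ℝ) i)
    have hid : ∫ x, x ∂G = m := integral_id_multivariateGaussian
    rw [hid] at this
    simpa using this
  have hprod : ∀ i j, ∫ t, t i * t j ∂G = Q⁻¹ i j + m i * m j := by
    intro i j
    have h1 := covariance_eval_multivariateGaussian (μ := m) hQ.inv.posSemidef i j
    rw [covariance_eq_sub (hmem i) (hmem j)] at h1
    simp only [Pi.mul_apply] at h1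
    rw [hmean, hmean] at h1
    linarith
  have hint1 : ∀ i, Integrable (fun t => b i * t i) G := fun i =>
    ((hmem i).integrable (by simp)).const_mul _
  have hint2 : ∀ i j, Integrable (fun t => t i * (Q i j * t j)) G := fun i j => by
    have := ((hmem i).integrable_mul (hmem j)).const_mul (Q i j)
    refine this.congr (ae_of_all _ fun t => ?_)
    simp only [Pi.mul_apply]; ring
  have hq : (quadFun c b Q) = fun t => c + ∑ i, b i * t i - (∑ i, ∑ j, t i * (Q i j * t j)) / 2 := by
    ext t
    simp only [quadFun, dotProduct, Matrix.mulVec, Finset.mul_sum]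
  have hintS : Integrable (fun t : EuclideanSpace ℝ (Fin d) => ∑ i, ∑ j, t i * (Q i j * t j)) G :=
    integrable_finsetSum _ fun i _ => integrable_finsetSum _ fun j _ => hint2 i j
  have hintb : Integrable (fun t : EuclideanSpace ℝ (Fin d) => ∑ i, b i * t i) G :=
    integrable_finsetSum _ fun i _ => hint1 i
  have hintq : Integrable (quadFun c b Q) G := by
    rw [hq]
    exact ((integrable_const c).add hintb).sub (hintS.div_const 2)
  have hvalS : ∫ t, (∑ i, ∑ j, t i * (Q i j * t j)) ∂G = d + b ⬝ᵥ Q⁻¹.mulVec b := by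
    rw [integral_finsetSum _ fun i _ => integrable_finsetSum _ fun j _ => hint2 i j]
    have h1 : ∀ i, ∫ t, ∑ j, t i * (Q i j * t j) ∂G
        = ∑ j, Q i j * Q⁻¹ j i + m i * ∑ j, Q i j * m j := by
      intro i
      rw [integral_finsetSum _ fun j _ => hint2 i j, Finset.mul_sum, ← Finset.sum_add_distrib]
      refine Finset.sum_congr rfl fun j _ => ?_
      have : ∫ t, t i * (Q i j * t j) ∂G = Q i j * ∫ t, t i * t j ∂G := by
        rw [← integral_const_mul]
        exact integral_congr_ae (ae_of_all _ fun t => by ring)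
      rw [this, hprod]
      have hs : Q⁻¹ i j = Q⁻¹ j i := by simpa using hQ.inv.1.apply j i
      rw [hs]; ring
    rw [Finset.sum_congr rfl fun i _ => h1 i, Finset.sum_add_distrib]
    congr 1
    · have : ∀ i, ∑ j, Q i j * Q⁻¹ j i = 1 := by
        intro i
        have := congrFun (congrFun (Matrix.mul_nonsing_inv _ hu) i) i
        rwa [Matrix.mul_apply, Matrix.one_apply_eq] at this
      rw [Finset.sum_congr rfl fun i _ => this i]
      simp
    · have h2 : ∀ i, ∑ j, Q i j * m j = b i := by
        intro i
        have : Q.mulVec (Q⁻¹.mulVec b) = b := by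
          rw [Matrix.mulVec_mulVec, Matrix.mul_nonsing_inv _ hu, Matrix.one_mulVec]
        exact congrFun this i
      rw [dotProduct_comm]
      exact Finset.sum_congr rfl fun i _ => by rw [h2]
  have hvalb : ∫ t, (∑ i, b i * t i) ∂G = b ⬝ᵥ Q⁻¹.mulVec b := by
    rw [integral_finsetSum _ fun i _ => hint1 i]
    refine Finset.sum_congr rfl fun i _ => ?_
    rw [integral_const_mul, hmean]
  have hval : ∫ t, quadFun c b Q t ∂G = c + b ⬝ᵥ Q⁻¹.mulVec b - (d + b ⬝ᵥ Q⁻¹.mulVec b) / 2 := by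
    have hi : Integrable (fun t : EuclideanSpace ℝ (Fin d) => c + ∑ i, b i * t i) G :=
      (integrable_const c).add hintb
    simp only [hq]
    rw [integral_sub hi (hintS.div_const 2),
      integral_add (integrable_const c) hintb, integral_div, hvalS, hvalb]
    simp
  have hm1 : Measurable fun t => ENNReal.ofReal (Real.exp (quadFun c b Q t)) := by
    have := (continuous_quadFun c b Q).measurable
    fun_prop
  have hlt : ∀ᵐ t : EuclideanSpace ℝ (Fin d), ENNReal.ofReal (Real.exp (quadFun c b Q t)) < ∞ :=
    ae_of_all _ fun t => ENNReal.ofReal_lt_top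
  have hneg : (fun t => Real.negMulLog (Real.exp (quadFun c b Q t)))
      = fun t => (ENNReal.ofReal (Real.exp (quadFun c b Q t))).toReal • (-quadFun c b Q t) := by
    ext t
    rw [ENNReal.toReal_ofReal (Real.exp_pos _).le, Real.negMulLog, Real.log_exp, smul_eq_mul]
    ring
  constructor
  · rw [hneg, ← integrable_withDensity_iff_integrable_smul' hm1 hlt, hG]
    exact hintq.neg
  · rw [diffEntropy, hneg, ← integral_withDensity_eq_integral_toReal_smul hm1 hlt, hG,
      integral_neg, hval, hc]
    ring

lemma quadFun_second_difference {Q : Matrix (Fin d) (Fin d) ℝ} (hQ : Q.IsHermitian) (c : ℝ)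
    (b : Fin d → ℝ) (i j : Fin d) :
    -(quadFun c b Q (EuclideanSpace.single i 1 + EuclideanSpace.single j 1)
      - quadFun c b Q (EuclideanSpace.single i 1) - quadFun c b Q (EuclideanSpace.single j 1)
      + quadFun c b Q 0) = Q i j := by
  have hsym : Q j i = Q i j := by simpa using hQ.apply i j
  simp [quadFun, Matrix.mulVec_add, hsym]
  ring

lemma fderiv_quadFun {Q : Matrix (Fin d) (Fin d) ℝ} (hQ : Q.IsHermitian) (c : ℝ)
    (b : Fin d → ℝ) (t v : EuclideanSpace ℝ (Fin d)) :
    fderiv ℝ (quadFun c b Q) t v = b ⬝ᵥ v.ofLp - v.ofLp ⬝ᵥ Q.mulVec t.ofLp := by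
  have hdiff : Differentiable ℝ (quadFun c b Q) := by
    unfold quadFun
    simp only [dotProduct, Matrix.mulVec]
    fun_prop
  have h1 : HasDerivAt (fun s : ℝ => quadFun c b Q (t + s • v))
      (fderiv ℝ (quadFun c b Q) t v) 0 := by
    have h2 := (hdiff t).hasFDerivAt.hasLineDerivAt v
    exact h2
  have h3 : HasDerivAt (fun s : ℝ => quadFun c b Q (t + s • v))
      (b ⬝ᵥ v.ofLp - v.ofLp ⬝ᵥ Q.mulVec t.ofLp) 0 := by
    have h4 : (fun s : ℝ => quadFun c b Q (t + s • v)) = fun s : ℝ => quadFun c b Q t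
        + s * (b ⬝ᵥ v.ofLp - v.ofLp ⬝ᵥ Q.mulVec t.ofLp)
        - s ^ 2 * (v.ofLp ⬝ᵥ Q.mulVec v.ofLp / 2) := by
      ext s
      have := dotProduct_mulVec_comm hQ t.ofLp v.ofLp
      simp only [quadFun, WithLp.ofLp_add, WithLp.ofLp_smul, dotProduct_add, add_dotProduct,
        Matrix.mulVec_add, Matrix.mulVec_smul, dotProduct_smul, smul_dotProduct, smul_eq_mul, this]
      ring
    rw [h4]
    have := (((hasDerivAt_id (0 : ℝ)).mul_const
      (b ⬝ᵥ v.ofLp - v.ofLp ⬝ᵥ Q.mulVec t.ofLp)).const_add (quadFun c b Q t)).sub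
      (((hasDerivAt_id (0 : ℝ)).pow 2).mul_const (v.ofLp ⬝ᵥ Q.mulVec v.ofLp / 2))
    refine HasDerivAt.congr_deriv this ?_
    simp
  exact h1.unique h3

lemma BayesModel.observedInfo_eq_of_quadFun {Y : Type*} [MeasurableSpace Y] {ν : Measure Y}
    (P : BayesModel d ν) {Q : Matrix (Fin d) (Fin d) ℝ} (hQ : Q.IsHermitian) {c : ℝ}
    {b : Fin d → ℝ} {y : Y} (h : ∀ t, P.lik y t = Real.exp (quadFun c b Q t))
    (t : EuclideanSpace ℝ (Fin d)) : P.observedInfo y t = Q := by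
  ext i j
  have h1 : (fun r => Real.log (P.lik y r)) = quadFun c b Q := by
    ext r; rw [h, Real.log_exp]
  simp only [BayesModel.observedInfo, Matrix.of_apply, h1, fderiv_quadFun hQ]
  -- the first derivatives are affine
  have h2 : (fun s : EuclideanSpace ℝ (Fin d) =>
      b ⬝ᵥ (EuclideanSpace.single j (1 : ℝ)).ofLp
        - (EuclideanSpace.single j (1 : ℝ)).ofLp ⬝ᵥ Q.mulVec s.ofLp)
      = quadFun (b j) (fun k => -Q j k) 0 := by
    ext s
    simp [quadFun, dotProduct, Matrix.mulVec, Finset.sum_neg_distrib, sub_eq_add_neg]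
  rw [h2, fderiv_quadFun Matrix.isHermitian_zero]
  have hsym : Q j i = Q i j := by simpa using hQ.apply i j
  simp [hsym]

end Quadratic

/-! ### Normal posteriors force quadratic log-likelihoods -/

lemma quadFun_sub {d : ℕ} (c c' : ℝ) (b b' : Fin d → ℝ) (Q Q' : Matrix (Fin d) (Fin d) ℝ)
    (t : EuclideanSpace ℝ (Fin d)) :
    quadFun c b Q t - quadFun c' b' Q' t = quadFun (c - c') (b - b') (Q - Q') t := by
  simp only [quadFun, sub_dotProduct, Matrix.sub_mulVec, dotProduct_sub]
  ring

lemma quadFun_add_quadFun {d : ℕ} (c c' : ℝ) (b b' : Fin d → ℝ) (Q Q' : Matrix (Fin d) (Fin d) ℝ)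
    (t : EuclideanSpace ℝ (Fin d)) :
    quadFun c b Q t + quadFun c' b' Q' t = quadFun (c + c') (b + b') (Q + Q') t := by
  simp only [quadFun, add_dotProduct, Matrix.add_mulVec, dotProduct_add]
  ring

lemma sum_quadFun {d n : ℕ} (c : Fin n → ℝ) (b : Fin n → Fin d → ℝ)
    (Q : Fin n → Matrix (Fin d) (Fin d) ℝ) (t : EuclideanSpace ℝ (Fin d)) :
    ∑ i, quadFun (c i) (b i) (Q i) t = quadFun (∑ i, c i) (∑ i, b i) (∑ i, Q i) t := by
  simp only [quadFun, Finset.sum_sub_distrib, Finset.sum_add_distrib, sum_dotProduct,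
    Matrix.sum_mulVec, dotProduct_sum, Finset.sum_div]

lemma exists_forall_mem_of_ae_pi {Y : Type*} [MeasurableSpace Y] {ν : Measure Y} [SigmaFinite ν]
    {S : Set Y} (hS : ν S ≠ 0) {n : ℕ} {p : (Fin n → Y) → Prop}
    (h : ∀ᵐ ys ∂Measure.pi (fun _ : Fin n => ν), p ys) : ∃ ys, (∀ i, ys i ∈ S) ∧ p ys := by
  by_contra! hno
  have h1 : Measure.pi (fun _ : Fin n => ν) (Set.univ.pi fun _ : Fin n => S) = 0 :=
    measure_mono_null (fun ys hys => hno ys fun i => hys i trivial) h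
  rw [Measure.pi_pi, Finset.prod_eq_zero_iff] at h1
  obtain ⟨_, _, h2⟩ := h1
  exact hS h2

namespace BayesModel

variable {d : ℕ} {Y : Type*} [MeasurableSpace Y] {ν : Measure Y} (P : BayesModel d ν)

/-- The negated second differences of `log p(y ∣ ·)` at the origin.  This is the observed
information when `log p(y ∣ ·)` is quadratic, and it is visibly measurable in `y`. -/
noncomputable def curvature (y : Y) : Matrix (Fin d) (Fin d) ℝ :=
  Matrix.of fun i j =>
    -(Real.log (P.lik y (EuclideanSpace.single i 1 + EuclideanSpace.single j 1))
      - Real.log (P.lik y (EuclideanSpace.single i 1))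
      - Real.log (P.lik y (EuclideanSpace.single j 1)) + Real.log (P.lik y 0))

/-- The log-likelihood of `y` is a quadratic polynomial. -/
noncomputable def IsQuadratic (y : Y) : Prop :=
  (P.curvature y).IsHermitian ∧
    ∃ c b, ∀ t, P.lik y t = Real.exp (quadFun c b (P.curvature y) t)

/-- The precision matrix of the posterior given `ys` in a normal model whose prior has precision
matrix `Q₀`. -/
noncomputable def precision (Q₀ : Matrix (Fin d) (Fin d) ℝ) {n : ℕ} (ys : Fin n → Y) :
    Matrix (Fin d) (Fin d) ℝ :=
  Q₀ + ∑ i, P.curvature (ys i)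

lemma measurable_lik_left (t : EuclideanSpace ℝ (Fin d)) : Measurable fun y => P.lik y t :=
  P.lik_measurable.comp (measurable_id.prodMk measurable_const)

lemma lik_nonneg (y : Y) (t : EuclideanSpace ℝ (Fin d)) : 0 ≤ P.lik y t := by
  rcases P.lik_support y with h | h
  · exact (h t).le
  · exact (h t).ge

lemma measurable_curvature_apply (i j : Fin d) : Measurable fun y => P.curvature y i j := by
  have := P.measurable_lik_left
  simp only [curvature, Matrix.of_apply]
  fun_prop

lemma curvature_eq_of_quadFun {Q : Matrix (Fin d) (Fin d) ℝ} (hQ : Q.IsHermitian) {c : ℝ}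
    {b : Fin d → ℝ} {y : Y} (h : ∀ t, P.lik y t = Real.exp (quadFun c b Q t)) :
    P.curvature y = Q := by
  ext i j
  simp only [curvature, Matrix.of_apply, h, Real.log_exp]
  exact quadFun_second_difference hQ c b i j

lemma IsQuadratic.observedInfo_eq {y : Y} (h : P.IsQuadratic y) (t : EuclideanSpace ℝ (Fin d)) :
    P.observedInfo y t = P.curvature y := by
  obtain ⟨hs, c, b, hcb⟩ := h
  exact P.observedInfo_eq_of_quadFun hs hcb t

lemma isProbabilityMeasure_priorMeasure : IsProbabilityMeasure P.priorMeasure :=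
  ⟨by rw [priorMeasure, withDensity_apply _ MeasurableSet.univ, Measure.restrict_univ,
    P.prior_mass]⟩

lemma isProbabilityMeasure_sampling (t : EuclideanSpace ℝ (Fin d)) :
    IsProbabilityMeasure (P.sampling t) :=
  ⟨by rw [sampling, withDensity_apply _ MeasurableSet.univ, Measure.restrict_univ, P.lik_mass t]⟩

lemma measurable_lik_eval {n : ℕ} (i : Fin n) :
    Measurable fun z : EuclideanSpace ℝ (Fin d) × (Fin n → Y) => P.lik (z.2 i) z.1 := by
  have h : Measurable fun z : EuclideanSpace ℝ (Fin d) × (Fin n → Y) => (z.2 i, z.1) := by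
    fun_prop
  exact P.lik_measurable.comp h

lemma measurable_jointDensity (n : ℕ) :
    Measurable fun z : EuclideanSpace ℝ (Fin d) × (Fin n → Y) => P.jointDensity z.2 z.1 := by
  unfold jointDensity
  exact (P.prior_measurable.comp measurable_fst).mul
    (Finset.measurable_prod _ fun i _ => P.measurable_lik_eval i)

lemma jointDensity_nonneg {n : ℕ} (ys : Fin n → Y) (t : EuclideanSpace ℝ (Fin d)) :
    0 ≤ P.jointDensity ys t :=
  mul_nonneg (P.prior_nonneg t) (Finset.prod_nonneg fun _ _ => P.lik_nonneg _ _)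

lemma measurable_jointDensity_right {n : ℕ} (ys : Fin n → Y) : Measurable (P.jointDensity ys) :=
  (P.measurable_jointDensity n).comp (measurable_id.prodMk measurable_const)

lemma measurable_evidence (n : ℕ) : Measurable fun ys : Fin n → Y =>
    ∫⁻ t, ENNReal.ofReal (P.jointDensity ys t) :=
  (P.measurable_jointDensity n).ennreal_ofReal.lintegral_prod_left'

lemma evidence_ne_zero {n : ℕ} {ys : Fin n → Y} (h : ∀ i t, 0 < P.lik (ys i) t) :
    ∫⁻ t, ENNReal.ofReal (P.jointDensity ys t) ≠ 0 := by
  intro h0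
  rw [lintegral_eq_zero_iff (P.measurable_jointDensity_right ys).ennreal_ofReal] at h0
  have h1 : (fun t => ENNReal.ofReal (P.prior t)) =ᵐ[volume] 0 := by
    filter_upwards [h0] with t ht
    simp only [Pi.zero_apply, ENNReal.ofReal_eq_zero, jointDensity] at ht ⊢
    have : 0 < ∏ i, P.lik (ys i) t := Finset.prod_pos fun i _ => h i t
    by_contra hp
    exact absurd ht (not_le.2 (mul_pos (not_le.1 hp) this))
  have h2 := lintegral_congr_ae h1
  rw [P.prior_mass] at h2
  simp at h2

/-- If the posterior given `ys` is normal, then the joint density is the exponential of a quadratic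
polynomial in `θ`. -/
lemma exists_jointDensity_eq_of_isGaussian {n : ℕ} {ys : Fin n → Y}
    (h : IsGaussian (P.posterior ys)) : ∃ c b Q, Q.IsHermitian ∧
      ∀ᵐ t, P.jointDensity ys t = Real.exp (quadFun c b Q t) := by
  have hac : P.posterior ys ≪ volume := withDensity_absolutelyContinuous _ _
  obtain ⟨m, S, hS, heq⟩ := exists_eq_multivariateGaussian hac
  rw [multivariateGaussian_eq_withDensity hS] at heq
  set c := (-(d / 2 * Real.log (2 * Real.pi)) - Real.log S.det / 2
        - (m.ofLp ⬝ᵥ S⁻¹.mulVec m.ofLp) / 2) with hc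
  have hmeas : Measurable fun t => ENNReal.ofReal (P.posteriorDensity ys t) :=
    ((P.measurable_jointDensity_right ys).div_const _).ennreal_ofReal
  have hmeas' : Measurable fun t =>
      ENNReal.ofReal (Real.exp (quadFun c (S⁻¹.mulVec m.ofLp) S⁻¹ t)) := by
    have := (continuous_quadFun c (S⁻¹.mulVec m.ofLp) S⁻¹).measurable
    fun_prop
  have hae := (withDensity_eq_iff_of_sigmaFinite hmeas.aemeasurable hmeas'.aemeasurable).1 heq
  set Z := ∫ s, P.jointDensity ys s with hZ
  have hZ0 : 0 ≤ Z := integral_nonneg fun t => P.jointDensity_nonneg ys t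
  refine ⟨c + Real.log Z, S⁻¹.mulVec m.ofLp, S⁻¹, hS.inv.1, ?_⟩
  filter_upwards [hae] with t ht
  have hpos := Real.exp_pos (quadFun c (S⁻¹.mulVec m.ofLp) S⁻¹ t)
  have hnn : 0 ≤ P.posteriorDensity ys t := div_nonneg (P.jointDensity_nonneg ys t) hZ0
  rw [ENNReal.ofReal_eq_ofReal_iff hnn hpos.le, posteriorDensity, ← hZ] at ht
  have hZne : Z ≠ 0 := by
    intro h0
    rw [h0, div_zero] at ht
    exact hpos.ne ht
  rw [div_eq_iff hZne] at ht
  rw [ht]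
  conv_lhs => rw [← Real.exp_log (lt_of_le_of_ne hZ0 hZne.symm), ← Real.exp_add]
  congr 1
  simp only [quadFun]
  ring

lemma measure_support_ne_zero : ν {y | ∀ t, 0 < P.lik y t} ≠ 0 := by
  intro h0
  have h1 : ∀ᵐ y ∂ν, ENNReal.ofReal (P.lik y 0) = 0 := by
    have : ∀ᵐ y ∂ν, ¬ ∀ t, 0 < P.lik y t := by
      rw [ae_iff]; simpa using h0
    filter_upwards [this] with y hy
    rw [(P.lik_support y).resolve_left hy, ENNReal.ofReal_zero]
  have h2 := P.lik_mass 0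
  rw [lintegral_congr_ae h1] at h2
  simp at h2

lemma jointDensity_cons {n : ℕ} (y : Y) (ys : Fin n → Y) (t : EuclideanSpace ℝ (Fin d)) :
    P.jointDensity (Fin.cons y ys : Fin (n + 1) → Y) t = P.jointDensity ys t * P.lik y t := by
  simp only [jointDensity, Fin.prod_univ_succ, Fin.cons_zero, Fin.cons_succ]
  ring

lemma prod_lik_eq {n : ℕ} {ys : Fin n → Y} (h : ∀ i, P.IsQuadratic (ys i)) :
    ∃ c b, ∀ t, ∏ i, P.lik (ys i) t
      = Real.exp (quadFun c b (∑ i, P.curvature (ys i)) t) := by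
  choose hs c b hcb using h
  refine ⟨∑ i, c i, ∑ i, b i, fun t => ?_⟩
  rw [← sum_quadFun, Real.exp_sum]
  exact Finset.prod_congr rfl fun i _ => hcb i t

variable [SigmaFinite ν]

lemma pi_sampling (n : ℕ) (t : EuclideanSpace ℝ (Fin d)) :
    Measure.pi (fun _ : Fin n => P.sampling t)
      = (Measure.pi fun _ : Fin n => ν).withDensity fun ys =>
          ∏ i, ENNReal.ofReal (P.lik (ys i) t) := by
  have := P.isProbabilityMeasure_sampling t
  have h : ∀ _ : Fin n, SigmaFinite (ν.withDensity fun y => ENNReal.ofReal (P.lik y t)) :=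
    fun _ => inferInstanceAs (SigmaFinite (P.sampling t))
  exact pi_withDensity (fun _ : Fin n => ν) (f := fun _ y => ENNReal.ofReal (P.lik y t))
    fun _ => (P.measurable_lik_left t).ennreal_ofReal

/-- Under the joint law, the data are independent draws from the sampling distribution given
`θ`. -/
lemma lintegral_joint {n : ℕ} {f : EuclideanSpace ℝ (Fin d) × (Fin n → Y) → ℝ≥0∞}
    (hf : Measurable f) :
    ∫⁻ z, f z ∂P.joint n
      = ∫⁻ t, ∫⁻ ys, f (t, ys) ∂Measure.pi (fun _ : Fin n => P.sampling t) ∂P.priorMeasure := by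
  have hjd := (P.measurable_jointDensity n).ennreal_ofReal
  have hprod : Measurable fun z : EuclideanSpace ℝ (Fin d) × (Fin n → Y) =>
      ∏ i, ENNReal.ofReal (P.lik (z.2 i) z.1) :=
    Finset.measurable_prod _ fun i _ => (P.measurable_lik_eval i).ennreal_ofReal
  have h1 : ∀ t, ∫⁻ ys, f (t, ys) ∂Measure.pi (fun _ : Fin n => P.sampling t)
      = ∫⁻ ys, (∏ i, ENNReal.ofReal (P.lik (ys i) t)) * f (t, ys) ∂Measure.pi fun _ => ν := by
    intro t
    rw [pi_sampling, lintegral_withDensity_eq_lintegral_mul]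
    · rfl
    · exact hprod.comp (measurable_const.prodMk measurable_id)
    · exact hf.comp (measurable_const.prodMk measurable_id)
  simp_rw [h1]
  rw [joint, lintegral_withDensity_eq_lintegral_mul _ hjd hf,
    lintegral_prod _ (hjd.mul hf).aemeasurable,
    priorMeasure, lintegral_withDensity_eq_lintegral_mul _ P.prior_measurable.ennreal_ofReal]
  · refine lintegral_congr fun t => ?_
    simp only [Pi.mul_apply]
    rw [← lintegral_const_mul]
    · refine lintegral_congr fun ys => ?_
      rw [jointDensity, ENNReal.ofReal_mul (P.prior_nonneg t),
        ENNReal.ofReal_prod_of_nonneg fun i _ => P.lik_nonneg _ _, mul_assoc]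
    · exact (hprod.mul hf).comp (measurable_const.prodMk measurable_id)
  · exact (hprod.mul hf).lintegral_prod_right'

lemma isProbabilityMeasure_joint (n : ℕ) : IsProbabilityMeasure (P.joint n) := by
  refine ⟨?_⟩
  have := P.isProbabilityMeasure_priorMeasure
  have := P.isProbabilityMeasure_sampling
  rw [← lintegral_one, P.lintegral_joint measurable_const]
  simp

lemma isProbabilityMeasure_marginal (n : ℕ) : IsProbabilityMeasure (P.marginal n) := by
  have := P.isProbabilityMeasure_joint n
  exact inferInstanceAs (IsProbabilityMeasure (P.joint n).snd)

lemma marginal_eq_withDensity (n : ℕ) :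
    P.marginal n = (Measure.pi fun _ : Fin n => ν).withDensity fun ys =>
      ∫⁻ t, ENNReal.ofReal (P.jointDensity ys t) := by
  have hjd := (P.measurable_jointDensity n).ennreal_ofReal
  ext s hs
  rw [marginal, Measure.snd_apply hs, joint, withDensity_apply _ (measurable_snd hs),
    withDensity_apply _ hs, ← Set.univ_prod, ← Measure.prod_restrict, Measure.restrict_univ,
    lintegral_prod_symm _ hjd.aemeasurable]

lemma ae_pi_of_ae_marginal {n : ℕ} {p : (Fin n → Y) → Prop} (h : ∀ᵐ ys ∂P.marginal n, p ys) :
    ∀ᵐ ys ∂Measure.pi (fun _ : Fin n => ν), (∀ i t, 0 < P.lik (ys i) t) → p ys := by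
  rw [marginal_eq_withDensity, ae_withDensity_iff (P.measurable_evidence n)] at h
  filter_upwards [h] with ys hys hpos
  exact hys (P.evidence_ne_zero hpos)

lemma ae_marginal_of_ae_pi {n : ℕ} {p : (Fin n → Y) → Prop}
    (h : ∀ᵐ ys ∂Measure.pi (fun _ : Fin n => ν), p ys) : ∀ᵐ ys ∂P.marginal n, p ys := by
  rw [marginal_eq_withDensity]
  exact (withDensity_absolutelyContinuous _ _).ae_le h

/-- Almost surely the evidence is positive and finite, and all the data lie in the common
support. -/
lemma ae_marginal_evidence (n : ℕ) : ∀ᵐ ys ∂P.marginal n, (∀ i t, 0 < P.lik (ys i) t) ∧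
    ∫⁻ t, ENNReal.ofReal (P.jointDensity ys t) ≠ ∞ := by
  have hfin : ∀ᵐ ys ∂Measure.pi (fun _ : Fin n => ν),
      ∫⁻ t, ENNReal.ofReal (P.jointDensity ys t) < ∞ := by
    refine ae_lt_top (P.measurable_evidence n) ?_
    have h1 := (P.isProbabilityMeasure_marginal n).measure_univ
    rw [marginal_eq_withDensity, withDensity_apply _ MeasurableSet.univ,
      Measure.restrict_univ] at h1
    rw [h1]
    exact ENNReal.one_ne_top
  have hpos : ∀ᵐ ys ∂P.marginal n, ∀ i t, 0 < P.lik (ys i) t := by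
    rw [marginal_eq_withDensity, ae_withDensity_iff (P.measurable_evidence n)]
    refine ae_of_all _ fun ys hne i => ?_
    rcases P.lik_support (ys i) with h | h
    · exact h
    · refine absurd ?_ hne
      have : ∀ t, ENNReal.ofReal (P.jointDensity ys t) = 0 := fun t => by
        rw [jointDensity, Finset.prod_eq_zero (Finset.mem_univ i) (h t), mul_zero,
          ENNReal.ofReal_zero]
      simp [this]
  filter_upwards [hpos, P.ae_marginal_of_ae_pi hfin] with ys h1 h2
  exact ⟨h1, h2.ne⟩

/-- A property that holds almost everywhere holds for some data in the common support. -/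
lemma exists_of_ae_pi {n : ℕ} {p : (Fin n → Y) → Prop}
    (h : ∀ᵐ ys ∂Measure.pi (fun _ : Fin n => ν), p ys) :
    ∃ ys, (∀ i t, 0 < P.lik (ys i) t) ∧ p ys :=
  exists_forall_mem_of_ae_pi P.measure_support_ne_zero h

/-- Comparing the normal posteriors given `M` and `M + 1` data, the likelihood of the additional
observation is the exponential of a quadratic polynomial. -/
lemma ae_isQuadratic
    (h : ∀ᶠ M : ℕ in atTop, ∀ᵐ ys ∂P.marginal M, IsGaussian (P.posterior ys)) :
    ∀ᵐ y ∂ν, (∀ t, 0 < P.lik y t) → P.IsQuadratic y := by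
  obtain ⟨M, hM⟩ := eventually_atTop.1 h
  have h0 := P.ae_pi_of_ae_marginal (hM M le_rfl)
  have h1 := P.ae_pi_of_ae_marginal (hM (M + 1) (Nat.le_succ M))
  have hmp := (measurePreserving_piFinSuccAbove (fun _ : Fin (M + 1) => ν) 0).symm.comp
    (Measure.measurePreserving_swap (μ := Measure.pi fun _ : Fin M => ν) (ν := ν))
  have h2 := Measure.ae_ae_of_ae_prod (hmp.quasiMeasurePreserving.ae h1)
  obtain ⟨ys, hpos, hG, hy⟩ := P.exists_of_ae_pi (h0.and h2)
  obtain ⟨c, b, Q, hQ, hq⟩ := P.exists_jointDensity_eq_of_isGaussian (hG hpos)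
  filter_upwards [hy] with y hy hypos
  have hcons : ((MeasurableEquiv.piFinSuccAbove (fun _ : Fin (M + 1) => Y) 0).symm ∘ Prod.swap)
      (ys, y) = (Fin.cons y ys : Fin (M + 1) → Y) := by
    simp [MeasurableEquiv.piFinSuccAbove_symm_apply]
    rfl
  rw [hcons] at hy
  obtain ⟨c', b', Q', hQ', hq'⟩ := P.exists_jointDensity_eq_of_isGaussian
    (hy fun i => Fin.cases hypos hpos i)
  have hae : P.lik y =ᵐ[volume] fun t => Real.exp (quadFun (c' - c) (b' - b) (Q' - Q) t) := by
    filter_upwards [hq, hq'] with t ht ht'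
    rw [jointDensity_cons, ht] at ht'
    rw [← quadFun_sub, Real.exp_sub, ← ht', mul_div_cancel_left₀ _ (Real.exp_pos _).ne']
  have hall := ((P.lik_contDiff y).continuous.ae_eq_iff_eq volume
    (Real.continuous_exp.comp (continuous_quadFun _ _ _))).1 hae
  have hcurv := P.curvature_eq_of_quadFun (hQ'.sub hQ) (congrFun hall)
  exact ⟨hcurv ▸ hQ'.sub hQ, _, _, fun t => by rw [hcurv]; exact congrFun hall t⟩

lemma ae_pi_isQuadratic (h : ∀ᵐ y ∂ν, (∀ t, 0 < P.lik y t) → P.IsQuadratic y) (n : ℕ) :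
    ∀ᵐ ys ∂Measure.pi (fun _ : Fin n => ν), (∀ i t, 0 < P.lik (ys i) t) →
      ∀ i, P.IsQuadratic (ys i) := by
  have : ∀ᵐ ys ∂Measure.pi (fun _ : Fin n => ν), ∀ i,
      (∀ t, 0 < P.lik (ys i) t) → P.IsQuadratic (ys i) :=
    eventually_all.2 fun i =>
      (Measure.tendsto_eval_ae_ae (μ := fun _ : Fin n => ν) (i := i)).eventually h
  filter_upwards [this] with ys hys hpos i
  exact hys i (hpos i)

/-- The prior is normal as well. -/
lemma exists_prior_eq
    (h : ∀ᶠ M : ℕ in atTop, ∀ᵐ ys ∂P.marginal M, IsGaussian (P.posterior ys)) :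
    ∃ c b Q, Q.IsHermitian ∧ ∀ᵐ t, P.prior t = Real.exp (quadFun c b Q t) := by
  obtain ⟨M, hM⟩ := h.exists
  obtain ⟨ys, hpos, hG, hquad⟩ := P.exists_of_ae_pi
    ((P.ae_pi_of_ae_marginal hM).and (P.ae_pi_isQuadratic (P.ae_isQuadratic h) M))
  obtain ⟨c, b, Q, hQ, hq⟩ := P.exists_jointDensity_eq_of_isGaussian (hG hpos)
  obtain ⟨c', b', hcb⟩ := P.prod_lik_eq (hquad hpos)
  have hH : (∑ i, P.curvature (ys i)).IsHermitian := by
    rw [Matrix.IsHermitian, Matrix.conjTranspose_sum]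
    exact Finset.sum_congr rfl fun i _ => (hquad hpos i).1
  refine ⟨c - c', b - b', Q - ∑ i, P.curvature (ys i), hQ.sub hH, ?_⟩
  filter_upwards [hq] with t ht
  rw [jointDensity, hcb] at ht
  rw [← quadFun_sub, Real.exp_sub, ← ht, mul_div_cancel_right₀ _ (Real.exp_pos _).ne']

/-- The posteriors of a model with normal prior and quadratic log-likelihoods are normal with
precision matrix `P.precision Q₀ ys`. -/
lemma ae_posteriorDensity_eq (h : ∀ᵐ y ∂ν, (∀ t, 0 < P.lik y t) → P.IsQuadratic y)
    {c₀ : ℝ} {b₀ : Fin d → ℝ} {Q₀ : Matrix (Fin d) (Fin d) ℝ} (hQ₀ : Q₀.IsHermitian)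
    (hprior : ∀ᵐ t, P.prior t = Real.exp (quadFun c₀ b₀ Q₀ t)) (n : ℕ) :
    ∀ᵐ ys ∂P.marginal n, (∀ i, P.IsQuadratic (ys i)) ∧ (P.precision Q₀ ys).PosDef ∧
      ∃ c b, (∀ᵐ t, P.posteriorDensity ys t
        = Real.exp (quadFun c b (P.precision Q₀ ys) t)) ∧
        ∫⁻ t, ENNReal.ofReal (Real.exp (quadFun c b (P.precision Q₀ ys) t)) = 1 := by
  filter_upwards [P.ae_marginal_evidence n, P.ae_marginal_of_ae_pi (P.ae_pi_isQuadratic h n)]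
    with ys hys hquad
  have hq := hquad hys.1
  obtain ⟨c, b, hcb⟩ := P.prod_lik_eq hq
  have hH : (P.precision Q₀ ys).IsHermitian := by
    refine hQ₀.add ?_
    rw [Matrix.IsHermitian, Matrix.conjTranspose_sum]
    exact Finset.sum_congr rfl fun i _ => (hq i).1
  have hjd : ∀ᵐ t, P.jointDensity ys t
      = Real.exp (quadFun (c₀ + c) (b₀ + b) (P.precision Q₀ ys) t) := by
    filter_upwards [hprior] with t ht
    rw [jointDensity, ht, hcb, ← Real.exp_add, quadFun_add_quadFun, precision]
  have hlint : ∫⁻ t, ENNReal.ofReal (P.jointDensity ys t)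
      = ∫⁻ t, ENNReal.ofReal (Real.exp (quadFun (c₀ + c) (b₀ + b) (P.precision Q₀ ys) t)) :=
    lintegral_congr_ae (by filter_upwards [hjd] with t ht; rw [ht])
  have hpd : (P.precision Q₀ ys).PosDef :=
    posDef_of_lintegral_exp_quadFun_ne_top hH (by rw [← hlint]; exact hys.2)
  set Z := ∫ s, P.jointDensity ys s with hZ
  have hZ' : ENNReal.ofReal Z = ∫⁻ t, ENNReal.ofReal (P.jointDensity ys t) := by
    refine ofReal_integral_eq_lintegral_ofReal ?_ (ae_of_all _ fun t => P.jointDensity_nonneg ys t)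
    exact (lintegral_ofReal_ne_top_iff_integrable
      (P.measurable_jointDensity_right ys).aestronglyMeasurable
      (ae_of_all _ fun t => P.jointDensity_nonneg ys t)).1 hys.2
  have hZpos : 0 < Z := by
    rw [← ENNReal.ofReal_pos, hZ']
    exact pos_iff_ne_zero.2 (P.evidence_ne_zero hys.1)
  have hsplit : ∀ t, Real.exp (quadFun (c₀ + c - Real.log Z) (b₀ + b) (P.precision Q₀ ys) t)
      = Real.exp (quadFun (c₀ + c) (b₀ + b) (P.precision Q₀ ys) t) / Z := by
    intro t
    conv_rhs => rw [← Real.exp_log hZpos, ← Real.exp_sub]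
    congr 1
    simp only [quadFun]
    ring
  refine ⟨hq, hpd, c₀ + c - Real.log Z, b₀ + b, ?_, ?_⟩
  · filter_upwards [hjd] with t ht
    rw [hsplit, ← ht, posteriorDensity]
  · simp_rw [hsplit, ENNReal.ofReal_div_of_pos hZpos, div_eq_mul_inv]
    rw [lintegral_mul_const' _ _ (by simp [hZpos]), ← hlint, ← hZ']
    exact ENNReal.mul_inv_cancel (by simp [hZpos]) ENNReal.ofReal_ne_top

/-- The posterior covariance and entropy in a normal model. -/
lemma ae_posteriorCov_eq (h : ∀ᵐ y ∂ν, (∀ t, 0 < P.lik y t) → P.IsQuadratic y)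
    {c₀ : ℝ} {b₀ : Fin d → ℝ} {Q₀ : Matrix (Fin d) (Fin d) ℝ} (hQ₀ : Q₀.IsHermitian)
    (hprior : ∀ᵐ t, P.prior t = Real.exp (quadFun c₀ b₀ Q₀ t)) (n : ℕ) :
    ∀ᵐ ys ∂P.marginal n, P.posteriorCov ys = (P.precision Q₀ ys)⁻¹ ∧
      Integrable (fun t => Real.negMulLog (P.posteriorDensity ys t)) ∧
      diffEntropy (P.posteriorDensity ys) = d / 2 * (Real.log (2 * Real.pi) + 1)
        - Real.log (P.precision Q₀ ys).det / 2 := by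
  filter_upwards [P.ae_posteriorDensity_eq h hQ₀ hprior n] with ys ⟨_, hpd, c, b, hae, hmass⟩
  obtain ⟨hint, hent⟩ := entropy_exp_quadFun hpd hmass
  refine ⟨?_, hint.congr ?_, ?_⟩
  · rw [← covariance_exp_quadFun hpd hmass, posteriorCov, posterior]
    have : (volume.withDensity fun t => ENNReal.ofReal (P.posteriorDensity ys t))
        = volume.withDensity fun t =>
          ENNReal.ofReal (Real.exp (quadFun c b (P.precision Q₀ ys) t)) :=
      withDensity_congr_ae (by filter_upwards [hae] with t ht; rw [ht])
    rw [this]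
  · filter_upwards [hae] with t ht
    rw [ht]
  · rw [← hent, diffEntropy, diffEntropy]
    exact integral_congr_ae (by filter_upwards [hae] with t ht; rw [ht])

end BayesModel

/-! ### Symmetric random matrices with bounded second moment -/

section RandomMatrix

variable {Ω : Type*} [MeasurableSpace Ω] {μ : Measure Ω} {d : ℕ}
  {X : Ω → Matrix (Fin d) (Fin d) ℝ} {α : ℝ}

lemma MatIntegrable.of_mul_self [IsFiniteMeasure μ] (hm : ∀ i j, Measurable fun ω => X ω i j)
    (hX : ∀ᵐ ω ∂μ, (X ω).IsHermitian) (h : MatIntegrable μ fun ω => X ω * X ω) :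
    MatIntegrable μ X := by
  intro i j
  refine ((integrable_const (1 : ℝ)).add (h i i)).mono' (hm i j).aestronglyMeasurable ?_
  filter_upwards [hX] with ω hω
  have h1 : X ω i j ^ 2 ≤ (X ω * X ω) i i := by
    rw [Matrix.mul_apply]
    have h2 : ∀ k, X ω i k * X ω k i = X ω i k ^ 2 := fun k => by
      have : X ω k i = X ω i k := by simpa using hω.apply i k
      rw [this, sq]
    simp_rw [h2]
    exact Finset.single_le_sum (f := fun k => X ω i k ^ 2) (fun k _ => sq_nonneg _)
      (Finset.mem_univ j)
  simp only [Real.norm_eq_abs, Pi.add_apply]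
  rcases abs_cases (X ω i j) with ⟨h, _⟩ | ⟨h, _⟩ <;> rw [h] <;>
    nlinarith [sq_nonneg (X ω i j - 1), sq_nonneg (X ω i j + 1)]

lemma MatIntegrable.integrable_trace_mul (h : MatIntegrable μ X)
    (Q : Matrix (Fin d) (Fin d) ℝ) : Integrable (fun ω => (Q * X ω).trace) μ := by
  simp only [Matrix.trace, Matrix.diag_apply, Matrix.mul_apply]
  exact integrable_finsetSum _ fun i _ => integrable_finsetSum _ fun j _ => (h j i).const_mul _

lemma MatIntegrable.integral_trace_mul (h : MatIntegrable μ X)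
    (Q : Matrix (Fin d) (Fin d) ℝ) :
    ∫ ω, (Q * X ω).trace ∂μ = (Q * matExp μ X).trace := by
  simp only [Matrix.trace, Matrix.diag_apply, Matrix.mul_apply, matExp, Matrix.of_apply]
  have hi : ∀ i j, Integrable (fun ω => Q i j * X ω j i) μ := fun i j => (h j i).const_mul _
  rw [integral_finsetSum _ fun i _ => integrable_finsetSum _ fun j _ => hi i j]
  refine Finset.sum_congr rfl fun i _ => ?_
  rw [integral_finsetSum _ fun j _ => hi i j]
  exact Finset.sum_congr rfl fun j _ => integral_const_mul _ _

lemma MatIntegrable.matExp_posSemidef (h : MatIntegrable μ X)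
    (hX : ∀ᵐ ω ∂μ, (X ω).PosSemidef) : (matExp μ X).PosSemidef := by
  refine .of_dotProduct_mulVec_nonneg ?_ fun x => ?_
  · ext i j
    simp only [Matrix.conjTranspose_apply, star_trivial, matExp, Matrix.of_apply]
    refine integral_congr_ae ?_
    filter_upwards [hX] with ω hω
    simpa using hω.1.apply i j
  · have key : ∀ M : Matrix (Fin d) (Fin d) ℝ,
        star x ⬝ᵥ M.mulVec x = (Matrix.vecMulVec x x * M).trace := by
      intro M
      rw [star_trivial, Matrix.vecMulVec_mul, Matrix.trace_vecMulVec, Matrix.dotProduct_mulVec,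
        dotProduct_comm]
    rw [key, ← h.integral_trace_mul]
    refine integral_nonneg_of_ae ?_
    filter_upwards [hX] with ω hω
    rw [Pi.zero_apply, ← key]
    exact hω.dotProduct_mulVec_nonneg x

lemma trace_mul_le_of_smul_one_sub {Q M : Matrix (Fin d) (Fin d) ℝ} (hQ : Q.PosSemidef)
    (h : (α • (1 : Matrix (Fin d) (Fin d) ℝ) - M).PosSemidef) :
    (Q * M).trace ≤ α * Q.trace := by
  have := hQ.trace_mul_nonneg h
  rw [mul_sub, Matrix.trace_sub, Matrix.mul_smul, mul_one, Matrix.trace_smul, smul_eq_mul] at this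
  linarith

/-- If `E X² ≼ α`, then `E X ≼ (1 + α) / 2`, here in the form tested against `Q ≽ 0`. -/
lemma trace_mul_matExp_le [IsFiniteMeasure μ] (hm : ∀ i j, Measurable fun ω => X ω i j)
    (hX : ∀ᵐ ω ∂μ, (X ω).IsHermitian) (hX2 : MatIntegrable μ fun ω => X ω * X ω)
    (h : (α • (1 : Matrix (Fin d) (Fin d) ℝ) - matExp μ fun ω => X ω * X ω).PosSemidef)
    (hμ : μ.real Set.univ = 1) {Q : Matrix (Fin d) (Fin d) ℝ} (hQ : Q.PosSemidef) :
    (Q * matExp μ X).trace ≤ (1 + α) / 2 * Q.trace := by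
  have hXi := MatIntegrable.of_mul_self hm hX hX2
  have h1 : ∫ ω, 2 * (Q * X ω).trace ∂μ ≤ ∫ ω, (Q.trace + (Q * (X ω * X ω)).trace) ∂μ := by
    refine integral_mono_ae ((hXi.integrable_trace_mul Q).const_mul 2)
      ((integrable_const _).add (hX2.integrable_trace_mul Q)) ?_
    filter_upwards [hX] with ω hω
    exact hQ.two_mul_trace_mul_le hω
  rw [integral_const_mul, integral_add (integrable_const _) (hX2.integrable_trace_mul Q),
    hXi.integral_trace_mul, hX2.integral_trace_mul, integral_const, hμ, one_smul] at h1
  have h2 := trace_mul_le_of_smul_one_sub hQ h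
  linarith

end RandomMatrix

/-! ### Measurability of matrix functions -/

section Measurability

variable {Ω : Type*} [MeasurableSpace Ω] {d : ℕ} {X : Ω → Matrix (Fin d) (Fin d) ℝ}

lemma measurable_det (h : ∀ i j, Measurable fun ω => X ω i j) : Measurable fun ω => (X ω).det := by
  simp only [Matrix.det_apply]
  refine Finset.measurable_sum _ fun σ _ => Measurable.const_smul ?_ _
  exact Finset.measurable_prod _ fun i _ => h _ _

lemma measurable_inv_apply (h : ∀ i j, Measurable fun ω => X ω i j) (i j : Fin d) :
    Measurable fun ω => (X ω)⁻¹ i j := by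
  simp only [Matrix.inv_def, Matrix.smul_apply, Ring.inverse_eq_inv', smul_eq_mul,
    Matrix.adjugate_apply]
  refine (measurable_det h).inv.mul (measurable_det fun k l => ?_)
  by_cases hk : k = j
  · subst hk; simp
  · simp only [Matrix.updateRow_ne hk]; exact h k l

lemma isClosed_posSemidef :
    IsClosed {M : Matrix (Fin d) (Fin d) ℝ | M.PosSemidef} := by
  simp only [Matrix.posSemidef_iff_dotProduct_mulVec, Set.ofPred_and, Set.ofPred_forall]
  refine IsClosed.inter ?_ (isClosed_iInter fun x => ?_)
  · exact isClosed_eq (by fun_prop) continuous_id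
  · exact isClosed_le continuous_const (by fun_prop)

lemma measurableSet_posSemidef (h : ∀ i j, Measurable fun ω => X ω i j) :
    MeasurableSet {ω | (X ω).PosSemidef} := by
  let X' : Ω → Fin d → Fin d → ℝ := fun ω i j => X ω i j
  have hX : Measurable X' :=
    measurable_pi_lambda _ fun i => measurable_pi_lambda _ fun j => h i j
  have hc : IsClosed {M : Fin d → Fin d → ℝ | Matrix.PosSemidef (M : Matrix (Fin d) (Fin d) ℝ)} :=
    isClosed_posSemidef
  exact hX hc.measurableSet

open scoped MatrixOrder in
lemma eq_of_mul_self_eq {M N : Matrix (Fin d) (Fin d) ℝ} (hM : M.PosSemidef) (hN : N.PosSemidef)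
    (h : M * M = N * N) : M = N := by
  rw [← CFC.sqrt_mul_self M (Matrix.nonneg_iff_posSemidef.2 hM), h,
    CFC.sqrt_mul_self N (Matrix.nonneg_iff_posSemidef.2 hN)]

open scoped MatrixOrder in
lemma matSqrt_of_not_posSemidef {M : Matrix (Fin d) (Fin d) ℝ} (hM : ¬M.PosSemidef) :
    matSqrt M = 0 := by
  rw [matSqrt, CFC.sqrt, cfcₙ_apply_of_not_predicate]
  rwa [Matrix.nonneg_iff_posSemidef]

open scoped Classical in
/-- The square root of positive semidefinite matrices is measurable by the Lusin-Souslin theorem,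
since it inverts the continuous injection `M ↦ M²`.  Other matrices have the square root `0`. -/
lemma measurable_matSqrt_apply (h : ∀ i j, Measurable fun ω => X ω i j) (i j : Fin d) :
    Measurable fun ω => matSqrt (X ω) i j := by
  let S : Set (Fin d → Fin d → ℝ) := {M | Matrix.PosSemidef (Matrix.of M)}
  have hS : IsClosed S := isClosed_posSemidef
  let f : (Fin d → Fin d → ℝ) → Fin d → Fin d → ℝ := fun M i j => ∑ k, M i k * M k j
  have hfM : ∀ M, Matrix.of (f M) = Matrix.of M * Matrix.of M := fun M => by
    ext i j
    simp [f, Matrix.mul_apply]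
  have hf : Continuous f := by fun_prop
  have hinj : Set.InjOn f S := by
    intro M hM N hN hMN
    have h1 : Matrix.of M * Matrix.of M = Matrix.of N * Matrix.of N := by
      rw [← hfM, ← hfM, hMN]
    exact Matrix.of.injective (eq_of_mul_self_eq hM hN h1)
  have hemb : MeasurableEmbedding (S.domRestrict f) :=
    hf.continuousOn.measurableEmbedding hS.measurableSet hinj
  have hg : Measurable fun ω => (⟨Matrix.of.symm (matSqrt (X ω)), matSqrt_posSemidef _⟩ : S) := by
    rw [← hemb.measurable_comp_iff]
    have : (S.domRestrict f ∘ fun ω =>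
        (⟨Matrix.of.symm (matSqrt (X ω)), matSqrt_posSemidef _⟩ : S))
        = fun ω i j => if (X ω).PosSemidef then X ω i j else 0 := by
      ext1 ω
      refine Matrix.of.injective ((hfM _).trans ?_)
      change matSqrt (X ω) * matSqrt (X ω) = _
      by_cases hX : (X ω).PosSemidef
      · simp only [hX, if_true]
        exact matSqrt_mul_self hX
      · simp only [hX, if_false, matSqrt_of_not_posSemidef hX, mul_zero]
        rfl
    rw [this]
    exact measurable_pi_lambda _ fun i => measurable_pi_lambda _ fun j =>
      Measurable.ite (measurableSet_posSemidef h) (h i j) measurable_const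
  exact (measurable_pi_apply j).comp ((measurable_pi_apply i).comp (measurable_subtype_coe.comp hg))

end Measurability

/-! ### Product measures -/

lemma map_comp_pi {Y : Type*} [MeasurableSpace Y] (μ : Measure Y) [IsProbabilityMeasure μ]
    {m n : ℕ} {σ : Fin m → Fin n} (hσ : Function.Injective σ) :
    (Measure.pi fun _ : Fin n => μ).map (fun ys => ys ∘ σ) = Measure.pi fun _ : Fin m => μ := by
  have hm : Measurable fun ys : Fin n → Y => ys ∘ σ :=
    measurable_pi_lambda _ fun i => measurable_pi_apply (σ i)
  refine (Measure.pi_eq fun s hs => ?_).symm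
  rw [Measure.map_apply hm (MeasurableSet.univ_pi hs)]
  have h1 : (fun ys : Fin n → Y => ys ∘ σ) ⁻¹' Set.univ.pi s
      = Set.univ.pi (Function.extend σ s fun _ => Set.univ) := by
    ext ys
    simp only [Set.mem_preimage, Set.mem_pi, Set.mem_univ, true_implies, Function.comp_apply]
    constructor
    · intro h i
      by_cases hi : ∃ j, σ j = i
      · obtain ⟨j, rfl⟩ := hi
        rw [hσ.extend_apply]
        exact h j
      · rw [Function.extend_apply' _ _ _ hi]
        trivial
    · intro h j
      have := h (σ j)
      rwa [hσ.extend_apply] at this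
  rw [h1, Measure.pi_pi]
  symm
  refine Fintype.prod_of_injective σ hσ _ _ (fun i hi => ?_) fun j => ?_
  · rw [Function.extend_apply' _ _ _ (by simpa using hi), measure_univ]
  · rw [hσ.extend_apply]

lemma lintegral_pi_castSucc_mul_last {Y : Type*} [MeasurableSpace Y] (μ : Measure Y)
    [SigmaFinite μ] {n : ℕ} {f : (Fin n → Y) → ℝ≥0∞} {g : Y → ℝ≥0∞} (hf : Measurable f)
    (hg : Measurable g) :
    ∫⁻ ys, f (ys ∘ Fin.castSucc) * g (ys (Fin.last n)) ∂Measure.pi (fun _ : Fin (n + 1) => μ)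
      = (∫⁻ zs, f zs ∂Measure.pi fun _ : Fin n => μ) * ∫⁻ y, g y ∂μ := by
  have hmp := measurePreserving_piFinSuccAbove (fun _ : Fin (n + 1) => μ) (Fin.last n)
  have h1 : ∀ ys : Fin (n + 1) → Y, f (ys ∘ Fin.castSucc) * g (ys (Fin.last n))
      = (fun z : Y × (Fin n → Y) => g z.1 * f z.2)
        (MeasurableEquiv.piFinSuccAbove (fun _ => Y) (Fin.last n) ys) := by
    intro ys
    rw [mul_comm]
    simp only [MeasurableEquiv.piFinSuccAbove_apply]
    congr 2
    ext i
    simp [Fin.init]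
  have hm : Measurable fun z : Y × (Fin n → Y) => g z.1 * f z.2 := by fun_prop
  rw [lintegral_congr h1, hmp.lintegral_comp hm,
    lintegral_prod_mul hg.aemeasurable hf.aemeasurable, mul_comm]

/-! ### Expectations in normal models -/

namespace BayesModel

variable {d : ℕ} {Y : Type*} [MeasurableSpace Y] {ν : Measure Y} (P : BayesModel d ν)

/-- The prior is normal with precision matrix `Q₀`, the log-likelihoods are quadratic, and the
observed information, which then does not depend on `θ`, has conditional second moment at most `γ`
in the Loewner order. -/
structure IsNormalModel (Q₀ : Matrix (Fin d) (Fin d) ℝ) (γ : ℝ) : Prop where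
  isHermitian : Q₀.IsHermitian
  prior_eq : ∃ c b, ∀ᵐ t, P.prior t = Real.exp (quadFun c b Q₀ t)
  ae_isQuadratic : ∀ᵐ y ∂ν, (∀ t, 0 < P.lik y t) → P.IsQuadratic y
  ae_second_moment : ∀ᵐ t ∂P.priorMeasure,
    MatIntegrable (P.sampling t) (fun y => P.curvature y * P.curvature y) ∧
    (γ • (1 : Matrix (Fin d) (Fin d) ℝ)
      - matExp (P.sampling t) fun y => P.curvature y * P.curvature y).PosSemidef

lemma ae_sampling {p : Y → Prop} (h : ∀ᵐ y ∂ν, (∀ t, 0 < P.lik y t) → p y)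
    (t : EuclideanSpace ℝ (Fin d)) : ∀ᵐ y ∂P.sampling t, p y := by
  rw [sampling, ae_withDensity_iff (P.measurable_lik_left t).ennreal_ofReal]
  filter_upwards [h] with y hy hne
  refine hy ((P.lik_support y).resolve_right fun h0 => hne ?_)
  rw [h0, ENNReal.ofReal_zero]

lemma exists_isNormalModel [SigmaFinite ν] {γ : ℝ}
    (h : ∀ᶠ M : ℕ in atTop, ∀ᵐ ys ∂P.marginal M, IsGaussian (P.posterior ys))
    (hsub : P.ObservedInfoSubexponential γ) : ∃ Q₀, P.IsNormalModel Q₀ γ := by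
  obtain ⟨c, b, Q₀, hQ₀, hprior⟩ := P.exists_prior_eq h
  have hquad := P.ae_isQuadratic h
  refine ⟨Q₀, hQ₀, ⟨c, b, hprior⟩, hquad, ?_⟩
  obtain ⟨α, β, hα, hβ, hαβ, hae⟩ := hsub
  filter_upwards [hae] with t ht
  obtain ⟨hint, hpsd⟩ := ht 2 le_rfl
  have hJ : ∀ᵐ y ∂P.sampling t, P.observedInfo y t ^ 2 = P.curvature y * P.curvature y := by
    filter_upwards [P.ae_sampling hquad t] with y hy
    rw [hy.observedInfo_eq, sq]
  have hint' : MatIntegrable (P.sampling t) fun y => P.curvature y * P.curvature y := fun i j =>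
    (hint i j).congr (by filter_upwards [hJ] with y hy; rw [hy])
  have hexp : matExp (P.sampling t) (fun y => P.observedInfo y t ^ 2)
      = matExp (P.sampling t) fun y => P.curvature y * P.curvature y := by
    ext i j
    exact integral_congr_ae (by filter_upwards [hJ] with y hy; rw [hy])
  refine ⟨hint', ?_⟩
  rw [hexp] at hpsd
  have h1 : ((γ - α) • (1 : Matrix (Fin d) (Fin d) ℝ)).PosSemidef :=
    Matrix.PosSemidef.one.smul (by linarith)
  have h2 := h1.add hpsd
  convert h2 using 1
  simp only [Nat.factorial_two, Nat.cast_ofNat, div_self (two_ne_zero (α := ℝ)), mul_one,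
    Nat.sub_self, pow_zero, sub_smul]
  abel

lemma measurePreserving_snd_joint (n : ℕ) :
    MeasurePreserving Prod.snd (P.joint n) (P.marginal n) := ⟨measurable_snd, rfl⟩

lemma measurable_precision_apply (Q₀ : Matrix (Fin d) (Fin d) ℝ) {n : ℕ} (i j : Fin d) :
    Measurable fun ys : Fin n → Y => P.precision Q₀ ys i j := by
  simp only [precision, Matrix.add_apply, Matrix.sum_apply]
  exact measurable_const.add (Finset.measurable_sum _ fun k _ =>
    (P.measurable_curvature_apply i j).comp (measurable_pi_apply k))

lemma measurable_trace_curvature : Measurable fun y => (P.curvature y).trace :=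
  Finset.measurable_sum _ fun i _ => P.measurable_curvature_apply i i

lemma measurable_log_det (Q₀ : Matrix (Fin d) (Fin d) ℝ) (n : ℕ) :
    Measurable fun ys : Fin n → Y => Real.log (P.precision Q₀ ys).det :=
  (measurable_det (P.measurable_precision_apply Q₀)).log

lemma IsNormalModel.fisherInfo_eq {P : BayesModel d ν} {Q₀ : Matrix (Fin d) (Fin d) ℝ} {γ : ℝ}
    (h : P.IsNormalModel Q₀ γ) (t : EuclideanSpace ℝ (Fin d)) :
    P.fisherInfo t = matExp (P.sampling t) P.curvature := by
  ext i j
  refine integral_congr_ae ?_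
  filter_upwards [P.ae_sampling h.ae_isQuadratic t] with y hy
  rw [hy.observedInfo_eq]

variable [SigmaFinite ν]

lemma lintegral_marginal {n : ℕ} {f : (Fin n → Y) → ℝ≥0∞} (hf : Measurable f) :
    ∫⁻ ys, f ys ∂P.marginal n
      = ∫⁻ t, ∫⁻ ys, f ys ∂Measure.pi (fun _ : Fin n => P.sampling t) ∂P.priorMeasure := by
  rw [marginal, Measure.snd, lintegral_map hf measurable_snd]
  exact P.lintegral_joint (hf.comp measurable_snd)

/-- Any selection of distinct replications of the data has the same law. -/
lemma map_comp_marginal {m n : ℕ} {σ : Fin m → Fin n} (hσ : Function.Injective σ) :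
    (P.marginal n).map (fun ys => ys ∘ σ) = P.marginal m := by
  have hm : Measurable fun ys : Fin n → Y => ys ∘ σ :=
    measurable_pi_lambda _ fun i => measurable_pi_apply (σ i)
  have := P.isProbabilityMeasure_sampling
  ext s hs
  have hind : Measurable (s.indicator (1 : (Fin m → Y) → ℝ≥0∞)) := measurable_one.indicator hs
  rw [← lintegral_indicator_one hs, ← lintegral_indicator_one hs, lintegral_map hind hm,
    P.lintegral_marginal (f := fun ys => s.indicator 1 (ys ∘ σ)) (hind.comp hm), P.lintegral_marginal hind]
  refine lintegral_congr fun t => ?_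
  rw [← map_comp_pi (P.sampling t) hσ, lintegral_map hind hm]

lemma measurePreserving_comp_marginal {m n : ℕ} {σ : Fin m → Fin n} (hσ : Function.Injective σ) :
    MeasurePreserving (fun ys => ys ∘ σ) (P.marginal n) (P.marginal m) :=
  ⟨measurable_pi_lambda _ fun i => measurable_pi_apply (σ i), P.map_comp_marginal hσ⟩

lemma measurePreserving_fst_joint (n : ℕ) :
    MeasurePreserving Prod.fst (P.joint n) P.priorMeasure := by
  refine ⟨measurable_fst, ?_⟩
  have := P.isProbabilityMeasure_sampling
  ext s hs
  have hind : Measurable (s.indicator (1 : EuclideanSpace ℝ (Fin d) → ℝ≥0∞)) :=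
    measurable_one.indicator hs
  rw [← lintegral_indicator_one hs, ← lintegral_indicator_one hs, lintegral_map hind measurable_fst,
    P.lintegral_joint (f := fun z => s.indicator 1 z.1) (hind.comp measurable_fst)]
  simp

namespace IsNormalModel

variable {P} {Q₀ : Matrix (Fin d) (Fin d) ℝ} {γ : ℝ}

lemma ae_posDef (h : P.IsNormalModel Q₀ γ) (n : ℕ) :
    ∀ᵐ ys ∂P.marginal n, (P.precision Q₀ ys).PosDef := by
  obtain ⟨c, b, hcb⟩ := h.prior_eq
  filter_upwards [P.ae_posteriorDensity_eq h.ae_isQuadratic h.isHermitian hcb n] with ys hys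
  exact hys.2.1

lemma posDef (h : P.IsNormalModel Q₀ γ) : Q₀.PosDef := by
  have := P.isProbabilityMeasure_marginal 0
  obtain ⟨ys, hys⟩ := (h.ae_posDef 0).exists
  simpa [precision] using hys

/-- The observed information is positive semidefinite: if `⟨v, A(y) v⟩ ≤ -ε` on a set of data of
positive measure, then the posterior precision would be indefinite for many such data. -/
lemma ae_curvature_posSemidef (h : P.IsNormalModel Q₀ γ) :
    ∀ᵐ y ∂ν, (∀ t, 0 < P.lik y t) → (P.curvature y).PosSemidef := by
  have key : ∀ (v : Fin d → ℝ) (k : ℕ), ∀ᵐ y ∂ν, (∀ t, 0 < P.lik y t) →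
      -(1 / ((k : ℝ) + 1)) ≤ v ⬝ᵥ (P.curvature y).mulVec v := by
    intro v k
    by_contra hne
    set N : Set Y := {y | ¬((∀ t, 0 < P.lik y t) →
      -(1 / ((k : ℝ) + 1)) ≤ v ⬝ᵥ (P.curvature y).mulVec v)} with hN
    have hN0 : ν N ≠ 0 := fun h0 => hne h0
    obtain ⟨n, hn⟩ := exists_nat_gt (((k : ℝ) + 1) * (v ⬝ᵥ Q₀.mulVec v))
    obtain ⟨ys, hys, hpd⟩ := exists_forall_mem_of_ae_pi hN0
      (P.ae_pi_of_ae_marginal (h.ae_posDef n))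
    simp only [hN, Set.mem_ofPred_eq, Classical.not_imp, not_le] at hys
    have h1 := (hpd fun i => (hys i).1).posSemidef.dotProduct_mulVec_nonneg v
    have h2 : ∑ i, v ⬝ᵥ (P.curvature (ys i)).mulVec v ≤ ∑ _i : Fin n, -(1 / ((k : ℝ) + 1)) :=
      Finset.sum_le_sum fun i _ => (hys i).2.le
    rw [star_trivial, precision, Matrix.add_mulVec, dotProduct_add, Matrix.sum_mulVec,
      dotProduct_sum] at h1
    rw [Finset.sum_const, Finset.card_univ, Fintype.card_fin, nsmul_eq_mul] at h2
    have hk : (0 : ℝ) < k + 1 := by positivity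
    have h3 : (k + 1 : ℝ) * (n * -(1 / ((k : ℝ) + 1))) = -n := by field_simp
    nlinarith [mul_le_mul_of_nonneg_left h2 hk.le]
  have hall : ∀ᵐ y ∂ν, ∀ (m k : ℕ), (∀ t, 0 < P.lik y t) → -(1 / ((k : ℝ) + 1))
      ≤ TopologicalSpace.denseSeq (Fin d → ℝ) m ⬝ᵥ
        (P.curvature y).mulVec (TopologicalSpace.denseSeq (Fin d → ℝ) m) :=
    ae_all_iff.2 fun m => ae_all_iff.2 fun k => key _ k
  filter_upwards [hall, h.ae_isQuadratic] with y hy hquad hpos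
  refine .of_dotProduct_mulVec_nonneg (hquad hpos).1 fun x => ?_
  rw [star_trivial]
  have hcl : IsClosed {x : Fin d → ℝ | 0 ≤ x ⬝ᵥ (P.curvature y).mulVec x} :=
    isClosed_le continuous_const (by fun_prop)
  refine (hcl.closure_subset_iff (s := Set.range (TopologicalSpace.denseSeq (Fin d → ℝ)))).2 ?_
    ((TopologicalSpace.denseRange_denseSeq (Fin d → ℝ)) x)
  rintro _ ⟨m, rfl⟩
  have h0 : Tendsto (fun k : ℕ => -(1 / ((k : ℝ) + 1))) atTop (nhds (-0)) :=
    tendsto_one_div_add_atTop_nhds_zero_nat.neg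
  rw [neg_zero] at h0
  exact le_of_tendsto' h0 fun k => hy m k hpos

lemma ae_sampling_posSemidef (h : P.IsNormalModel Q₀ γ) (t : EuclideanSpace ℝ (Fin d)) :
    ∀ᵐ y ∂P.sampling t, (P.curvature y).PosSemidef :=
  P.ae_sampling h.ae_curvature_posSemidef t

lemma ae_marginal_posSemidef (h : P.IsNormalModel Q₀ γ) (n : ℕ) :
    ∀ᵐ ys ∂P.marginal n, ∀ i, (P.curvature (ys i)).PosSemidef := by
  have h1 : ∀ᵐ ys ∂Measure.pi (fun _ : Fin n => ν), ∀ i,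
      (∀ t, 0 < P.lik (ys i) t) → (P.curvature (ys i)).PosSemidef :=
    eventually_all.2 fun i => (Measure.tendsto_eval_ae_ae (μ := fun _ : Fin n => ν)
      (i := i)).eventually h.ae_curvature_posSemidef
  filter_upwards [P.ae_marginal_of_ae_pi h1, P.ae_marginal_evidence n] with ys hys hpos i
  exact hys i (hpos.1 i)

lemma ae_matIntegrable (h : P.IsNormalModel Q₀ γ) :
    ∀ᵐ t ∂P.priorMeasure, MatIntegrable (P.sampling t) P.curvature := by
  filter_upwards [h.ae_second_moment] with t ht
  have := P.isProbabilityMeasure_sampling t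
  refine MatIntegrable.of_mul_self P.measurable_curvature_apply ?_ ht.1
  filter_upwards [h.ae_sampling_posSemidef t] with y hy
  exact hy.1

lemma ae_fisherInfo_posSemidef (h : P.IsNormalModel Q₀ γ) :
    ∀ᵐ t ∂P.priorMeasure, (P.fisherInfo t).PosSemidef := by
  filter_upwards [h.ae_matIntegrable] with t ht
  rw [h.fisherInfo_eq]
  exact ht.matExp_posSemidef (h.ae_sampling_posSemidef t)

lemma ae_trace_mul_fisherInfo_le (h : P.IsNormalModel Q₀ γ) : ∀ᵐ t ∂P.priorMeasure,
    ∀ Q : Matrix (Fin d) (Fin d) ℝ, Q.PosSemidef →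
      (Q * P.fisherInfo t).trace ≤ (1 + γ) / 2 * Q.trace := by
  filter_upwards [h.ae_second_moment] with t ht Q hQ
  have := P.isProbabilityMeasure_sampling t
  rw [h.fisherInfo_eq]
  refine trace_mul_matExp_le P.measurable_curvature_apply ?_ ht.1 ht.2 (by simp) hQ
  filter_upwards [h.ae_sampling_posSemidef t] with y hy
  exact hy.1

/-- `E tr A(y⁽ⁱ⁾) < ∞`. -/
lemma integrable_trace_curvature (h : P.IsNormalModel Q₀ γ) {n : ℕ} (i : Fin n) :
    Integrable (fun ys => (P.curvature (ys i)).trace) (P.marginal n) := by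
  have hm : Measurable fun ys : Fin n → Y => (P.curvature (ys i)).trace :=
    P.measurable_trace_curvature.comp (measurable_pi_apply i)
  have hnn : 0 ≤ᵐ[P.marginal n] fun ys => (P.curvature (ys i)).trace := by
    filter_upwards [h.ae_marginal_posSemidef n] with ys hys
    exact (hys i).trace_nonneg
  rw [← lintegral_ofReal_ne_top_iff_integrable hm.aestronglyMeasurable hnn,
    P.lintegral_marginal hm.ennreal_ofReal]
  have hle : ∀ᵐ t ∂P.priorMeasure, ∫⁻ ys, ENNReal.ofReal (P.curvature (ys i)).trace
      ∂Measure.pi (fun _ : Fin n => P.sampling t) ≤ ENNReal.ofReal ((1 + γ) / 2 * d) := by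
    filter_upwards [h.ae_matIntegrable, h.ae_trace_mul_fisherInfo_le] with t ht htr
    have := P.isProbabilityMeasure_sampling t
    have hmp := measurePreserving_eval (fun _ : Fin n => P.sampling t) i
    have h1 := hmp.lintegral_comp P.measurable_trace_curvature.ennreal_ofReal
    simp only [Function.eval] at h1
    have h2 := ht.integrable_trace_mul 1
    have h3 := ht.integral_trace_mul 1
    have h4 := htr 1 Matrix.PosSemidef.one
    simp only [one_mul, Matrix.trace_one, Fintype.card_fin] at h2 h3 h4
    rw [h1, ← ofReal_integral_eq_lintegral_ofReal h2, h3, ← h.fisherInfo_eq]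
    · exact ENNReal.ofReal_le_ofReal h4
    · filter_upwards [h.ae_sampling_posSemidef t] with y hy
      exact hy.trace_nonneg
  refine ((lintegral_mono_ae hle).trans_lt ?_).ne
  have := P.isProbabilityMeasure_priorMeasure
  rw [lintegral_const, measure_univ, mul_one]
  exact ENNReal.ofReal_lt_top

lemma integrable_log_det (h : P.IsNormalModel Q₀ γ) (n : ℕ) :
    Integrable (fun ys => Real.log (P.precision Q₀ ys).det) (P.marginal n) := by
  have := P.isProbabilityMeasure_marginal n
  have hb : Integrable (fun ys => |Real.log Q₀.det| + |Q₀.trace|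
      + ∑ i, (P.curvature (ys i)).trace) (P.marginal n) :=
    (integrable_const _).add (integrable_finsetSum _ fun i _ => h.integrable_trace_curvature i)
  refine hb.mono' (P.measurable_log_det Q₀ n).aestronglyMeasurable ?_
  filter_upwards [h.ae_posDef n, h.ae_marginal_posSemidef n] with ys hpd hpsd
  have h1 := h.posDef.log_det_le_log_det_add (Matrix.posSemidef_sum Finset.univ fun i _ => hpsd i)
  have h2 := hpd.log_det_le_trace
  have h4 : 0 ≤ ∑ i, (P.curvature (ys i)).trace := Finset.sum_nonneg fun i _ => (hpsd i).trace_nonneg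
  have h5 : (P.precision Q₀ ys).trace = Q₀.trace + ∑ i, (P.curvature (ys i)).trace := by
    rw [precision, Matrix.trace_add, Matrix.trace_sum]
  rw [h5] at h2
  rw [Real.norm_eq_abs, abs_le]
  constructor
  · have h6 : Real.log Q₀.det ≤ Real.log (P.precision Q₀ ys).det := h1
    linarith [neg_abs_le (Real.log Q₀.det), abs_nonneg Q₀.trace]
  · linarith [le_abs_self Q₀.trace, abs_nonneg (Real.log Q₀.det)]

lemma ae_posteriorCov_eq (h : P.IsNormalModel Q₀ γ) (n : ℕ) : ∀ᵐ ys ∂P.marginal n,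
    P.posteriorCov ys = (P.precision Q₀ ys)⁻¹ ∧
      Integrable (fun t => Real.negMulLog (P.posteriorDensity ys t)) ∧
      diffEntropy (P.posteriorDensity ys) = d / 2 * (Real.log (2 * Real.pi) + 1)
        - Real.log (P.precision Q₀ ys).det / 2 := by
  obtain ⟨c, b, hcb⟩ := h.prior_eq
  exact P.ae_posteriorCov_eq h.ae_isQuadratic h.isHermitian hcb n

lemma condEntropyFinite (h : P.IsNormalModel Q₀ γ) (n : ℕ) : P.CondEntropyFinite n := by
  have := P.isProbabilityMeasure_marginal n
  constructor
  · filter_upwards [h.ae_posteriorCov_eq n] with ys hys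
    exact hys.2.1
  · refine ((integrable_const (d / 2 * (Real.log (2 * Real.pi) + 1))).sub
      ((h.integrable_log_det n).div_const 2)).congr ?_
    filter_upwards [h.ae_posteriorCov_eq n] with ys hys
    exact hys.2.2.symm

lemma condEntropy_eq (h : P.IsNormalModel Q₀ γ) (n : ℕ) :
    P.condEntropy n = d / 2 * (Real.log (2 * Real.pi) + 1)
    - (∫ ys, Real.log (P.precision Q₀ ys).det ∂P.marginal n) / 2 := by
  have := P.isProbabilityMeasure_marginal n
  have h1 : P.condEntropy n = ∫ ys, (d / 2 * (Real.log (2 * Real.pi) + 1)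
      - Real.log (P.precision Q₀ ys).det / 2) ∂P.marginal n :=
    integral_congr_ae (by filter_upwards [h.ae_posteriorCov_eq n] with ys hys; exact hys.2.2)
  rw [h1, integral_sub (integrable_const _) ((h.integrable_log_det n).div_const 2), integral_div]
  simp

/-- The information gained from one replication, after observing `m` others, is half the expected
increment of the log-determinant of the precision matrix. -/
lemma cmi_one_eq (h : P.IsNormalModel Q₀ γ) {m n : ℕ} {σ : Fin m → Fin n} (hσ : Function.Injective σ)
    {k : Fin n}
    (hk : ∀ j, σ j ≠ k) :
    Integrable (fun ys => Real.log (P.precision Q₀ (ys ∘ σ) + P.curvature (ys k)).det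
      - Real.log (P.precision Q₀ (ys ∘ σ)).det) (P.marginal n) ∧
    P.cmi 1 m = (∫ ys, (Real.log (P.precision Q₀ (ys ∘ σ) + P.curvature (ys k)).det
      - Real.log (P.precision Q₀ (ys ∘ σ)).det) ∂P.marginal n) / 2 := by
  have hτ : Function.Injective (Fin.snoc σ k : Fin (m + 1) → Fin n) :=
    Fin.snoc_injective_iff.2 ⟨hσ, fun ⟨j, hj⟩ => hk j hj⟩
  have hprec : ∀ ys : Fin n → Y, P.precision Q₀ (ys ∘ (Fin.snoc σ k : Fin (m + 1) → Fin n))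
      = P.precision Q₀ (ys ∘ σ) + P.curvature (ys k) := by
    intro ys
    simp only [precision, Fin.sum_univ_castSucc, Function.comp_apply, Fin.snoc_castSucc,
      Fin.snoc_last, add_assoc]
  have mp1 := P.measurePreserving_comp_marginal hσ
  have mp2 := P.measurePreserving_comp_marginal hτ
  have i1 := mp1.integrable_comp_of_integrable (h.integrable_log_det m)
  have i2 := mp2.integrable_comp_of_integrable (h.integrable_log_det (m + 1))
  have e1 : ∫ ys, Real.log (P.precision Q₀ (ys ∘ σ)).det ∂P.marginal n
      = ∫ ys, Real.log (P.precision Q₀ ys).det ∂P.marginal m := by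
    rw [← mp1.map_eq, integral_map mp1.measurable.aemeasurable
      (P.measurable_log_det Q₀ m).aestronglyMeasurable]
  have e2 : ∫ ys, Real.log (P.precision Q₀ (ys ∘ (Fin.snoc σ k : Fin (m + 1) → Fin n))).det
      ∂P.marginal n = ∫ ys, Real.log (P.precision Q₀ ys).det ∂P.marginal (m + 1) := by
    rw [← mp2.map_eq, integral_map mp2.measurable.aemeasurable
      (P.measurable_log_det Q₀ (m + 1)).aestronglyMeasurable]
  simp only [Function.comp_def] at i1 i2 e1 e2 hprec ⊢
  simp only [hprec] at i2 e2
  refine ⟨i2.sub i1, ?_⟩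
  rw [integral_sub i2 i1, e1, e2, cmi, h.condEntropy_eq, h.condEntropy_eq]
  ring

lemma condEntropy_succ_le (h : P.IsNormalModel Q₀ γ) (n : ℕ) :
    P.condEntropy (n + 1) ≤ P.condEntropy n := by
  have h1 := (h.cmi_one_eq (Fin.castSucc_injective n) (k := Fin.last n)
    fun j => (Fin.castSucc_lt_last j).ne).2
  have h2 : 0 ≤ P.cmi 1 n := by
    rw [h1]
    refine div_nonneg (integral_nonneg_of_ae ?_) zero_le_two
    have mp := P.measurePreserving_comp_marginal (Fin.castSucc_injective n)
    filter_upwards [mp.quasiMeasurePreserving.ae (h.ae_posDef n), h.ae_marginal_posSemidef (n + 1)]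
      with ys hpd hpsd
    rw [Pi.zero_apply, sub_nonneg]
    exact hpd.log_det_le_log_det_add (hpsd _)
  rw [cmi] at h2
  linarith

lemma cmi_one_le_cmi (h : P.IsNormalModel Q₀ γ) {M : ℕ} (hM : 1 ≤ M) (R : ℕ) :
    P.cmi 1 R ≤ P.cmi M R := by
  have := antitone_nat_of_succ_le h.condEntropy_succ_le (show R + 1 ≤ R + M by omega)
  simp only [cmi]
  linarith

/-- Diminishing returns: the first replication is the most informative one. -/
lemma cmi_one_le_cmi_one_one (h : P.IsNormalModel Q₀ γ) {R : ℕ} (hR : 1 ≤ R) :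
    P.cmi 1 R ≤ P.cmi 1 1 := by
  have hσ : Function.Injective fun _ : Fin 1 => (0 : Fin (R + 1)) := fun a b _ => Subsingleton.elim a b
  obtain ⟨i1, e1⟩ := h.cmi_one_eq (Fin.castSucc_injective R) (k := Fin.last R)
    fun j => (Fin.castSucc_lt_last j).ne
  obtain ⟨i2, e2⟩ := h.cmi_one_eq hσ (k := Fin.last R)
    fun j => by rw [Ne, Fin.ext_iff]; simp; omega
  rw [e1, e2]
  refine div_le_div_of_nonneg_right (integral_mono_ae i1 i2 ?_) zero_le_two
  have mp1 := P.measurePreserving_comp_marginal (Fin.castSucc_injective R)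
  have mp2 := P.measurePreserving_comp_marginal hσ
  filter_upwards [mp1.quasiMeasurePreserving.ae (h.ae_posDef R),
    mp2.quasiMeasurePreserving.ae (h.ae_posDef 1), h.ae_marginal_posSemidef (R + 1)]
    with ys hpd1 hpd2 hpsd
  refine hpd2.log_det_add_sub_antitone hpd1 ?_ (hpsd _)
  obtain ⟨r, rfl⟩ := Nat.exists_eq_succ_of_ne_zero (by omega : R ≠ 0)
  have : P.precision Q₀ (ys ∘ Fin.castSucc) - P.precision Q₀ (ys ∘ fun _ : Fin 1 => 0)
      = ∑ i : Fin r, P.curvature (ys i.succ.castSucc) := by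
    simp only [precision, Function.comp_apply, Finset.univ_unique, Finset.sum_singleton]
    rw [Fin.sum_univ_succ]
    simp
  rw [this]
  exact Matrix.posSemidef_sum _ fun i _ => hpsd _

end IsNormalModel
end BayesModel

/-! ### Bounds for the information and for the normalized Fisher information -/

lemma ofReal_integral_le_lintegral_ofReal {Ω : Type*} [MeasurableSpace Ω] {μ : Measure Ω}
    {f : Ω → ℝ} (hf : Integrable f μ) :
    ENNReal.ofReal (∫ ω, f ω ∂μ) ≤ ∫⁻ ω, ENNReal.ofReal (f ω) ∂μ := by
  rw [integral_eq_lintegral_pos_part_sub_lintegral_neg_part hf]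
  exact (ENNReal.ofReal_le_ofReal (sub_le_self _ ENNReal.toReal_nonneg)).trans
    ENNReal.ofReal_toReal_le

/-- Markov's inequality in the form `P (f < 1 / (4 B)) ≤ 1 / 4` if `E f⁻¹ ≤ B`, where `f` need not
be measurable. -/
lemma measure_le_quarter {Ω : Type*} [MeasurableSpace Ω] {μ : Measure Ω} {f : Ω → ℝ} {B : ℝ}
    (hB : 0 < B) (h : ∫⁻ ω, (ENNReal.ofReal (f ω))⁻¹ ∂μ ≤ ENNReal.ofReal B) {s : Set Ω}
    (hs : MeasurableSet s) (hf : ∀ᵐ ω ∂μ, ω ∈ s → f ω ≤ 1 / (4 * B)) :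
    μ s ≤ ENNReal.ofReal (1 / 4) := by
  have h1 : ENNReal.ofReal (4 * B) * μ s ≤ ENNReal.ofReal B := by
    rw [← lintegral_indicator_const hs]
    refine (lintegral_mono_ae ?_).trans h
    filter_upwards [hf] with ω hω
    by_cases hmem : ω ∈ s
    · rw [Set.indicator_of_mem hmem, ← inv_inv (ENNReal.ofReal (4 * B)),
        ← ENNReal.ofReal_inv_of_pos (by positivity), ENNReal.inv_le_inv]
      refine ENNReal.ofReal_le_ofReal ((hω hmem).trans_eq (one_div _))
    · rw [Set.indicator_of_notMem hmem]
      exact zero_le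
  have h2 : ENNReal.ofReal B = ENNReal.ofReal (4 * B) * ENNReal.ofReal (1 / 4) := by
    rw [← ENNReal.ofReal_mul (by positivity)]
    congr 1
    ring
  rw [h2] at h1
  exact (ENNReal.mul_le_mul_iff_right (by simp [hB]) ENNReal.ofReal_ne_top).1 h1

namespace BayesModel.IsNormalModel

variable {d : ℕ} {Y : Type*} [MeasurableSpace Y] {ν : Measure Y} [SigmaFinite ν]
  {P : BayesModel d ν} {Q₀ : Matrix (Fin d) (Fin d) ℝ} {γ B : ℝ} {R : ℕ}

lemma measurable_fisherInfo_apply (h : P.IsNormalModel Q₀ γ) (i j : Fin d) :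
    Measurable fun t => P.fisherInfo t i j := by
  have h1 : (fun t => P.fisherInfo t i j)
      = fun t => ∫ y, P.lik y t * P.curvature y i j ∂ν := by
    ext t
    rw [h.fisherInfo_eq, matExp, Matrix.of_apply, sampling,
      integral_withDensity_eq_integral_toReal_smul (P.measurable_lik_left t).ennreal_ofReal
        (ae_of_all _ fun _ => ENNReal.ofReal_lt_top)]
    refine integral_congr_ae (ae_of_all _ fun y => ?_)
    simp only [ENNReal.toReal_ofReal (P.lik_nonneg y t), smul_eq_mul]
  rw [h1]
  have h2 : Measurable fun z : EuclideanSpace ℝ (Fin d) × Y => P.lik z.2 z.1 * P.curvature z.2 i j :=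
    (P.lik_measurable.comp measurable_swap).mul
      ((P.measurable_curvature_apply i j).comp measurable_snd)
  exact h2.stronglyMeasurable.integral_prod_right'.measurable

/-- The lower bound on the information is linear in `d`: given `θ` with `tr I(θ) ≥ d / (4 B)`, an
event of probability at least `3 / 4`, and data with posterior precision at most `t⁻¹`, again of
probability at least `3 / 4`, the increment of the log-determinant has conditional expectation at
least `t tr I(θ) - t² γ d / 2`. -/
lemma le_cmi_one (h : P.IsNormalModel Q₀ γ) (hd : 0 < d) (hB : 0 < B)
    (hS : P.SpectralMomentsBounded R B) {t₀ : ℝ} (ht₀ : 0 < t₀) (ht₀B : t₀ ≤ 1 / (4 * B)) :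
    (t₀ / (4 * B) - t₀ ^ 2 / 2 * γ) * d / 4 ≤ P.cmi 1 R := by
  have hdR : (0 : ℝ) < d := by exact_mod_cast hd
  have := P.isProbabilityMeasure_sampling
  have := P.isProbabilityMeasure_priorMeasure
  have := P.isProbabilityMeasure_marginal
  obtain ⟨-, hcovB, -, hI⟩ := hS
  -- the two good events
  set E : Set (Fin R → Y) :=
    {zs | (t₀⁻¹ • (1 : Matrix (Fin d) (Fin d) ℝ) - P.precision Q₀ zs).PosSemidef} with hE
  set G : Set (EuclideanSpace ℝ (Fin d)) := {t | d / (4 * B) ≤ (P.fisherInfo t).trace} with hG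
  have hEm : MeasurableSet E := by
    refine measurableSet_posSemidef fun i j => ?_
    simp only [Matrix.sub_apply]
    exact measurable_const.sub (P.measurable_precision_apply Q₀ i j)
  have hGm : MeasurableSet G := measurableSet_le measurable_const
    (Finset.measurable_sum _ fun i _ => h.measurable_fisherInfo_apply i i)
  have hEc : P.marginal R Eᶜ ≤ ENNReal.ofReal (1 / 4) := by
    refine measure_le_quarter hB hcovB hEm.compl ?_
    filter_upwards [h.ae_posDef R, h.ae_posteriorCov_eq R] with zs hpd hcov hmem
    rw [hcov.1]
    by_contra! hlt
    refine hmem ?_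
    have hu := (Matrix.isUnit_iff_isUnit_det _).1 hpd.isUnit
    have h1 := hpd.inv.1.sub_smul_one_posSemidef (ht₀B.trans hlt.le)
    have h2 := (Matrix.PosDef.one.smul ht₀).inv_sub_inv_posSemidef hpd.inv h1
    have h3 : (t₀ • (1 : Matrix (Fin d) (Fin d) ℝ))⁻¹ = t₀⁻¹ • 1 := by
      refine Matrix.inv_eq_right_inv ?_
      rw [Matrix.smul_mul, one_mul, smul_smul, mul_inv_cancel₀ ht₀.ne', one_smul]
    rwa [h3, Matrix.nonsing_inv_nonsing_inv _ hu] at h2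
  have hGc : P.priorMeasure Gᶜ ≤ ENNReal.ofReal (1 / 4) := by
    refine measure_le_quarter hB hI hGm.compl ?_
    filter_upwards [h.ae_fisherInfo_posSemidef] with t hpsd hmem
    have h1 := hpsd.1.lamMin_mul_le_trace
    simp only [hG, Set.mem_compl_iff, Set.mem_ofPred_eq, not_le] at hmem
    have h2 : d * lamMin (P.fisherInfo t) ≤ d * (1 / (4 * B)) := by
      rw [mul_one_div]; linarith
    exact le_of_mul_le_mul_left h2 hdR
  set π : EuclideanSpace ℝ (Fin d) → ℝ≥0∞ := fun t => Measure.pi (fun _ : Fin R => P.sampling t) E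
    with hπ
  -- the two events hold simultaneously with probability at least one half
  have hX : ENNReal.ofReal (1 / 2) ≤ ∫⁻ t, G.indicator π t ∂P.priorMeasure := by
    have h1 : P.marginal R E = ∫⁻ t, π t ∂P.priorMeasure := by
      rw [← lintegral_indicator_one hEm, P.lintegral_marginal (measurable_one.indicator hEm)]
      exact lintegral_congr fun t => lintegral_indicator_one hEm
    have h2 : ∫⁻ t, π t ∂P.priorMeasure
        ≤ ∫⁻ t, (G.indicator π t + Gᶜ.indicator 1 t) ∂P.priorMeasure := by
      refine lintegral_mono fun t => ?_
      by_cases ht : t ∈ G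
      · rw [Set.indicator_of_mem ht]
        exact le_self_add
      · rw [Set.indicator_of_mem (show t ∈ Gᶜ from ht)]
        exact prob_le_one.trans le_add_self
    rw [lintegral_add_right _ (measurable_one.indicator hGm.compl),
      lintegral_indicator_one hGm.compl] at h2
    have h3 : (1 : ℝ≥0∞) = P.marginal R E + P.marginal R Eᶜ := by
      rw [measure_add_measure_compl hEm, measure_univ]
    have h4 : (1 : ℝ≥0∞) ≤ (∫⁻ t, G.indicator π t ∂P.priorMeasure) + ENNReal.ofReal (1 / 2) := by
      calc (1 : ℝ≥0∞) ≤ ((∫⁻ t, G.indicator π t ∂P.priorMeasure) + ENNReal.ofReal (1 / 4))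
            + ENNReal.ofReal (1 / 4) := by
            rw [h3, h1]
            exact add_le_add (h2.trans (add_le_add le_rfl hGc)) hEc
        _ = _ := by
            rw [add_assoc, ← ENNReal.ofReal_add (by norm_num) (by norm_num)]
            norm_num
    have h5 : (1 : ℝ≥0∞) = ENNReal.ofReal (1 / 2) + ENNReal.ofReal (1 / 2) := by
      rw [← ENNReal.ofReal_add (by norm_num) (by norm_num)]
      norm_num
    rw [h5] at h4
    exact (ENNReal.add_le_add_iff_right ENNReal.ofReal_ne_top).1 h4
  set κ := (t₀ / (4 * B) - t₀ ^ 2 / 2 * γ) * d with hκ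
  set f : Y → ℝ := fun y =>
    t₀ * (P.curvature y).trace - t₀ ^ 2 / 2 * (P.curvature y * P.curvature y).trace with hf
  have hfm : Measurable f := by
    have h1 : Measurable fun y => (P.curvature y * P.curvature y).trace := by
      simp only [Matrix.trace, Matrix.diag_apply, Matrix.mul_apply]
      exact Finset.measurable_sum _ fun i _ => Finset.measurable_sum _ fun j _ =>
        (P.measurable_curvature_apply i j).mul (P.measurable_curvature_apply j i)
    exact (P.measurable_trace_curvature.const_mul _).sub (h1.const_mul _)
  have hfκ : ∀ᵐ t ∂P.priorMeasure, t ∈ G →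
      ENNReal.ofReal κ ≤ ∫⁻ y, ENNReal.ofReal (f y) ∂P.sampling t := by
    filter_upwards [h.ae_matIntegrable, h.ae_second_moment] with t hint h2 htG
    have i1 := hint.integrable_trace_mul 1
    have i2 := h2.1.integrable_trace_mul 1
    have e1 := hint.integral_trace_mul 1
    have e2 := h2.1.integral_trace_mul 1
    have e3 := trace_mul_le_of_smul_one_sub Matrix.PosSemidef.one h2.2
    simp only [one_mul] at i1 i2 e1 e2 e3
    rw [Matrix.trace_one, Fintype.card_fin] at e3
    have hfi : Integrable f (P.sampling t) := (i1.const_mul _).sub (i2.const_mul _)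
    refine le_trans (ENNReal.ofReal_le_ofReal ?_) (ofReal_integral_le_lintegral_ofReal hfi)
    rw [hf, integral_sub (i1.const_mul _) (i2.const_mul _), integral_const_mul,
      integral_const_mul, e1, e2, ← h.fisherInfo_eq, hκ]
    have h3 : d / (4 * B) ≤ (P.fisherInfo t).trace := htG
    have h4 := mul_le_mul_of_nonneg_left h3 ht₀.le
    have h5 := mul_le_mul_of_nonneg_left e3 (by positivity : 0 ≤ t₀ ^ 2 / 2)
    calc (t₀ / (4 * B) - t₀ ^ 2 / 2 * γ) * d
        = t₀ * (d / (4 * B)) - t₀ ^ 2 / 2 * (γ * d) := by ring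
      _ ≤ _ := by linarith
  obtain ⟨hDi, hD⟩ := h.cmi_one_eq (Fin.castSucc_injective R) (k := Fin.last R)
    fun j => (Fin.castSucc_lt_last j).ne
  set D : (Fin (R + 1) → Y) → ℝ := fun ys =>
    Real.log (P.precision Q₀ (ys ∘ Fin.castSucc) + P.curvature (ys (Fin.last R))).det
      - Real.log (P.precision Q₀ (ys ∘ Fin.castSucc)).det with hDdef
  have mp := P.measurePreserving_comp_marginal (Fin.castSucc_injective R)
  have hgood : ∀ᵐ ys ∂P.marginal (R + 1), (P.precision Q₀ (ys ∘ Fin.castSucc)).PosDef ∧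
      (P.curvature (ys (Fin.last R))).PosSemidef := by
    filter_upwards [mp.quasiMeasurePreserving.ae (h.ae_posDef R), h.ae_marginal_posSemidef (R + 1)]
      with ys hpd hpsd
    exact ⟨hpd, hpsd _⟩
  have hD0 : 0 ≤ᵐ[P.marginal (R + 1)] D := by
    filter_upwards [hgood] with ys hys
    exact sub_nonneg.2 (hys.1.log_det_le_log_det_add hys.2)
  have hEi : Measurable (E.indicator (1 : (Fin R → Y) → ℝ≥0∞)) := measurable_one.indicator hEm
  have hlow : ENNReal.ofReal (κ / 2) ≤ ENNReal.ofReal (∫ ys, D ys ∂P.marginal (R + 1)) := by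
    calc ENNReal.ofReal (κ / 2) = ENNReal.ofReal (1 / 2) * ENNReal.ofReal κ := by
          rw [← ENNReal.ofReal_mul (by norm_num)]
          congr 1
          ring
      _ ≤ (∫⁻ t, G.indicator π t ∂P.priorMeasure) * ENNReal.ofReal κ := by gcongr
      _ = ∫⁻ t, G.indicator π t * ENNReal.ofReal κ ∂P.priorMeasure :=
          (lintegral_mul_const' _ _ ENNReal.ofReal_ne_top).symm
      _ ≤ ∫⁻ t, π t * ∫⁻ y, ENNReal.ofReal (f y) ∂P.sampling t ∂P.priorMeasure := by
          refine lintegral_mono_ae ?_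
          filter_upwards [hfκ] with t ht
          by_cases htG : t ∈ G
          · rw [Set.indicator_of_mem htG]
            exact mul_le_mul_right (ht htG) _
          · rw [Set.indicator_of_notMem htG, zero_mul]
            exact zero_le
      _ = ∫⁻ t, ∫⁻ ys, E.indicator 1 (ys ∘ Fin.castSucc) * ENNReal.ofReal (f (ys (Fin.last R)))
            ∂Measure.pi (fun _ : Fin (R + 1) => P.sampling t) ∂P.priorMeasure := by
          refine lintegral_congr fun t => ?_
          rw [lintegral_pi_castSucc_mul_last (P.sampling t) hEi hfm.ennreal_ofReal,
            lintegral_indicator_one hEm]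
      _ = ∫⁻ ys, E.indicator 1 (ys ∘ Fin.castSucc) * ENNReal.ofReal (f (ys (Fin.last R)))
            ∂P.marginal (R + 1) := by
          refine (P.lintegral_marginal ?_).symm
          exact (hEi.comp mp.measurable).mul
            (hfm.ennreal_ofReal.comp (measurable_pi_apply (Fin.last R)))
      _ ≤ ∫⁻ ys, ENNReal.ofReal (D ys) ∂P.marginal (R + 1) := by
          refine lintegral_mono_ae ?_
          filter_upwards [hgood] with ys ⟨hpd, hpsd⟩
          by_cases hmem : ys ∘ Fin.castSucc ∈ E
          · rw [Set.indicator_of_mem hmem, Pi.one_apply, one_mul]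
            exact ENNReal.ofReal_le_ofReal (hpd.le_log_det_add_sub ht₀ hmem hpsd)
          · rw [Set.indicator_of_notMem hmem, zero_mul]
            exact zero_le
      _ = ENNReal.ofReal (∫ ys, D ys ∂P.marginal (R + 1)) :=
          (ofReal_integral_eq_lintegral_ofReal hDi hD0).symm
  rw [ENNReal.ofReal_le_ofReal_iff (integral_nonneg_of_ae hD0)] at hlow
  rw [hD]
  linarith

/-- The trace of the normalized Fisher information is at most `(1 + γ) / 2 · tr Σ`, which has
expectation of order `d`. -/
lemma normalizedInfo_bound (h : P.IsNormalModel Q₀ γ) (hγ : 0 < γ) (hB : 0 < B)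
    (hS : P.SpectralMomentsBounded R B) :
    MatIntegrable (P.joint R) (P.normalizedInfo R) ∧
      (matExp (P.joint R) (P.normalizedInfo R)).trace ≤ (1 + γ) / 2 * (d * B) := by
  obtain ⟨hcovB, -, -, -⟩ := hS
  have hinvm : ∀ i j, Measurable fun ys : Fin R → Y => (P.precision Q₀ ys)⁻¹ i j :=
    measurable_inv_apply (P.measurable_precision_apply Q₀)
  set g : (Fin R → Y) → ℝ := fun ys => (P.precision Q₀ ys)⁻¹.trace with hg
  have hgm : Measurable g := Finset.measurable_sum _ fun i _ => hinvm i i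
  have hg0 : 0 ≤ᵐ[P.marginal R] g := by
    filter_upwards [h.ae_posDef R] with ys hys
    exact hys.inv.posSemidef.trace_nonneg
  have hglint : ∫⁻ ys, ENNReal.ofReal (g ys) ∂P.marginal R ≤ ENNReal.ofReal (d * B) := by
    calc ∫⁻ ys, ENNReal.ofReal (g ys) ∂P.marginal R
        ≤ ∫⁻ ys, ENNReal.ofReal d * ENNReal.ofReal (lamMax (P.posteriorCov ys))
            ∂P.marginal R := by
          refine lintegral_mono_ae ?_
          filter_upwards [h.ae_posDef R, h.ae_posteriorCov_eq R] with ys hpd hcov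
          rw [← ENNReal.ofReal_mul (Nat.cast_nonneg d), hcov.1]
          exact ENNReal.ofReal_le_ofReal hpd.inv.1.trace_le_mul_lamMax
      _ ≤ ENNReal.ofReal (d * B) := by
          rw [lintegral_const_mul' _ _ ENNReal.ofReal_ne_top, ENNReal.ofReal_mul (Nat.cast_nonneg d)]
          gcongr
  have hgi : Integrable g (P.marginal R) :=
    (lintegral_ofReal_ne_top_iff_integrable hgm.aestronglyMeasurable hg0).1
      (hglint.trans_lt ENNReal.ofReal_lt_top).ne
  have hgle : ∫ ys, g ys ∂P.marginal R ≤ d * B := by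
    rw [integral_eq_lintegral_of_nonneg_ae hg0 hgm.aestronglyMeasurable]
    exact ENNReal.toReal_le_of_le_ofReal (by positivity) hglint
  have mpf := P.measurePreserving_fst_joint R
  have mps := P.measurePreserving_snd_joint R
  have hgood : ∀ᵐ z ∂P.joint R, P.normalizedInfo R z
        = matSqrt (P.precision Q₀ z.2)⁻¹ * P.fisherInfo z.1 * matSqrt (P.precision Q₀ z.2)⁻¹ ∧
      (P.normalizedInfo R z).PosSemidef ∧
      (P.normalizedInfo R z).trace ≤ (1 + γ) / 2 * g z.2 := by
    filter_upwards [mps.quasiMeasurePreserving.ae (h.ae_posDef R),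
      mps.quasiMeasurePreserving.ae (h.ae_posteriorCov_eq R),
      mpf.quasiMeasurePreserving.ae h.ae_fisherInfo_posSemidef,
      mpf.quasiMeasurePreserving.ae h.ae_trace_mul_fisherInfo_le] with z hpd hcov hI htr
    have heq : P.normalizedInfo R z
        = matSqrt (P.precision Q₀ z.2)⁻¹ * P.fisherInfo z.1 * matSqrt (P.precision Q₀ z.2)⁻¹ := by
      rw [normalizedInfo, hcov.1]
    refine ⟨heq, ?_, ?_⟩
    · rw [heq]
      exact hI.conj (matSqrt_posSemidef _).1
    · rw [heq, Matrix.trace_mul_comm, ← mul_assoc, matSqrt_mul_self hpd.inv.posSemidef]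
      exact htr _ hpd.inv.posSemidef
  have hgi' : Integrable (fun z : EuclideanSpace ℝ (Fin d) × (Fin R → Y) => (1 + γ) / 2 * g z.2)
      (P.joint R) := (mps.integrable_comp_of_integrable hgi).const_mul _
  have hint : MatIntegrable (P.joint R) (P.normalizedInfo R) := by
    intro i j
    refine hgi'.mono' ?_ ?_
    · have hs : ∀ k l, Measurable fun z : EuclideanSpace ℝ (Fin d) × (Fin R → Y) =>
          matSqrt (P.precision Q₀ z.2)⁻¹ k l := fun k l =>
        (measurable_matSqrt_apply hinvm k l).comp measurable_snd
      have hf : ∀ k l, Measurable fun z : EuclideanSpace ℝ (Fin d) × (Fin R → Y) =>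
          P.fisherInfo z.1 k l := fun k l =>
        (h.measurable_fisherInfo_apply k l).comp measurable_fst
      have hm : Measurable fun z : EuclideanSpace ℝ (Fin d) × (Fin R → Y) =>
          (matSqrt (P.precision Q₀ z.2)⁻¹ * P.fisherInfo z.1
            * matSqrt (P.precision Q₀ z.2)⁻¹) i j := by
        simp only [Matrix.mul_apply]
        fun_prop
      refine ⟨_, hm.stronglyMeasurable, ?_⟩
      filter_upwards [hgood] with z hz
      rw [hz.1]
    · filter_upwards [hgood] with z hz
      exact (hz.2.1.abs_apply_le_trace i j).trans hz.2.2
  refine ⟨hint, ?_⟩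
  have e1 := hint.integral_trace_mul 1
  have i1 := hint.integrable_trace_mul 1
  simp only [one_mul] at e1 i1
  have e2 : ∫ z, g z.2 ∂P.joint R = ∫ ys, g ys ∂P.marginal R := by
    rw [← mps.map_eq, integral_map mps.measurable.aemeasurable hgm.aestronglyMeasurable]
  rw [← e1]
  calc ∫ z, (P.normalizedInfo R z).trace ∂P.joint R
      ≤ ∫ z, (1 + γ) / 2 * g z.2 ∂P.joint R :=
        integral_mono_ae i1 hgi' (by filter_upwards [hgood] with z hz; exact hz.2.2)
    _ = (1 + γ) / 2 * ∫ ys, g ys ∂P.marginal R := by rw [integral_const_mul, e2]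
    _ ≤ (1 + γ) / 2 * (d * B) := by gcongr

end BayesModel.IsNormalModel

lemma ceil_log_two_mul_le {d : ℕ} (hd : 2 ≤ d) :
    1 ≤ ⌈(1 : ℝ) * Real.log (2 * d)⌉₊ ∧
      (⌈(1 : ℝ) * Real.log (2 * d)⌉₊ : ℝ) ≤ 8 * Real.log d ∧ 1 / 8 ≤ Real.log d := by
  have hd' : (2 : ℝ) ≤ d := by exact_mod_cast hd
  have h2 := Real.log_two_gt_d9
  have h3 : Real.log 2 ≤ Real.log d := Real.log_le_log (by norm_num) hd'
  have h4 : Real.log (2 * d) = Real.log 2 + Real.log d :=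
    Real.log_mul (by norm_num) (by linarith)
  rw [one_mul, h4]
  refine ⟨Nat.one_le_ceil_iff.2 (by linarith), ?_, by linarith⟩
  have := Nat.ceil_lt_add_one (show 0 ≤ Real.log 2 + Real.log d by linarith)
  linarith

theorem theorem5 (γ B : ℝ) (hγ : 0 < γ) (hB : 0 < B) :
    ∃ C : ℝ, 0 < C ∧ ∃ K : ℝ, 0 < K ∧
      ∀ (d : ℕ), 2 ≤ d →
      ∀ (Y : Type*) [MeasurableSpace Y] (ν : Measure Y) [SigmaFinite ν] (P : BayesModel d ν)
        (R : ℕ), 1 ≤ R →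
        (∀ᶠ M : ℕ in atTop, ∀ᵐ ys ∂P.marginal M, IsGaussian (P.posterior ys)) →
        P.ObservedInfoSubexponential γ →
        P.SpectralMomentsBounded R B →
        -- all the expectations in the bounds below are finite
        (∀ n : ℕ, 1 ≤ n → P.CondEntropyFinite n) ∧
        MatIntegrable (P.joint R) (P.normalizedInfo R) ∧
        -- the bound on the conditional mutual information of one replication
        P.cmi 1 1 ≥ C / Real.log d * (matExp (P.joint R) (P.normalizedInfo R)).trace ∧
        -- the averaged bound for a number of replications of order `log d`
        1 / (⌈K * Real.log (2 * d)⌉₊ : ℝ) * P.cmi ⌈K * Real.log (2 * d)⌉₊ R ≥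
          C / Real.log d * (matExp (P.joint R) (P.normalizedInfo R)).trace := by
  -- `t` balances the linear against the quadratic term in `BayesModel.IsNormalModel.le_cmi_one`
  set t : ℝ := min (1 / (4 * B)) (1 / (4 * B * γ)) with ht
  have ht0 : 0 < t := lt_min (by positivity) (by positivity)
  have htB : t ≤ 1 / (4 * B) := min_le_left _ _
  have htγ : t * γ ≤ 1 / (4 * B) := by
    have h1 : t ≤ 1 / (4 * B * γ) := min_le_right _ _
    calc t * γ ≤ 1 / (4 * B * γ) * γ := by gcongr
      _ = 1 / (4 * B) := by field_simp
  set c : ℝ := t / (32 * B) with hc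
  have hc0 : 0 < c := by positivity
  have hcle : c ≤ (t / (4 * B) - t ^ 2 / 2 * γ) / 4 := by
    have h1 := mul_le_mul_of_nonneg_left htγ ht0.le
    have h2 : t * (1 / (4 * B)) = 8 * c := by rw [hc]; field_simp; norm_num
    have h3 : t / (4 * B) = 8 * c := by rw [hc]; field_simp; norm_num
    rw [h3]
    nlinarith
  set U : ℝ := (1 + γ) / 2 * B with hU
  have hU0 : 0 < U := by positivity
  refine ⟨c / (8 * U), by positivity, 1, one_pos, ?_⟩
  intro d hd Y _ ν _ P R hR hgauss hsub hS
  obtain ⟨Q₀, h⟩ := P.exists_isNormalModel hgauss hsub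
  obtain ⟨hint, htr⟩ := h.normalizedInfo_bound hγ hB hS
  obtain ⟨hM1, hM8, hlog⟩ := ceil_log_two_mul_le hd
  set M := ⌈(1 : ℝ) * Real.log (2 * d)⌉₊
  set τ := (matExp (P.joint R) (P.normalizedInfo R)).trace
  have hd0 : (0 : ℝ) < d := by exact_mod_cast (by omega : 0 < d)
  have hlog0 : 0 < Real.log d := by linarith
  have hM0 : (0 : ℝ) < M := by exact_mod_cast hM1
  have hlow : c * d ≤ P.cmi 1 R := by
    refine le_trans ?_ (h.le_cmi_one (by omega) hB hS ht0 htB)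
    rw [mul_div_right_comm]
    gcongr
  have hup : c / (8 * U) / Real.log d * τ ≤ c * d / (8 * Real.log d) := by
    calc c / (8 * U) / Real.log d * τ ≤ c / (8 * U) / Real.log d * ((1 + γ) / 2 * (d * B)) := by
          gcongr
      _ = c / (8 * U) / Real.log d * (U * d) := by rw [hU]; ring
      _ = c * d / (8 * Real.log d) := by field_simp
  refine ⟨fun n _ => h.condEntropyFinite n, hint, ?_, ?_⟩
  · refine (hup.trans ?_).trans (hlow.trans (h.cmi_one_le_cmi_one_one hR))
    exact div_le_self (by positivity) (by linarith)
  · refine hup.trans ?_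
    rw [one_div, inv_mul_eq_div]
    calc c * d / (8 * Real.log d) ≤ c * d / M := by gcongr
      _ ≤ P.cmi M R / M := by
          gcongr
          exact hlow.trans (h.cmi_one_le_cmi hM1 R)
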